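/- Call a function $I:\mathbb R\to[0,\infty]$ a good rate function if it is lower semicontinuous and all its level sets $\{x: I(x)\le a\}$, $a\in[0,\infty)$, are compact. A sequence $(Y_n)_{n\ge1}$ of real random variables on a probability space $(\Omega,\mathcal F,\mathbf P)$ satisfies a large deviation principle (LDP) with speed $n$ and good rate function $I$ if $I$ is a good rate function and, for every Borel set $\Gamma\subseteq\mathbb R$, $$-\inf_{x\in\Gamma^\circ}I(x)\le\liminf_{n\to\infty}\frac1n\log\mathbf P(Y_n\in\Gamma)\le\limsup_{n\to\infty}\frac1n\log\mathbf P(Y_n\in\Gamma)\le-\inf_{x\in\overline\Gamma}I(x),$$ where $\log 0=-\infty$, $\inf\emptyset=+\infty$, and $\Gamma^\circ$, $\overline\Gamma$ are the interior and the closure of $\Gamma$. Let $$I_C(x)=\begin{cases}x-\log(x+1),&x>-1,\\+\infty,&x\le-1.\end{cases}$$ **Corollary 1.2.** (1) Every $x\in(0,1)$ has a unique modified Engel series $$x=\frac1{d_1}+\frac1{(d_1-1)d_2}+\cdots+\frac1{(d_1-1)\cdots(d_{n-1}-1)d_n}+\cdots$$ with integers $d_n=d_n(x)$ such that $d_1\ge2$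 and $d_{n+1}\ge d_n+1$ for all $n\ge1$. On $(0,1)$ with its Borel $\sigma$-algebra and Lebesgue measure, the sequence $\left(\frac{\log d_n-n}{n}\right)_{n\ge1}$ satisfies an LDP with speed $n$ and good rate function $I_C$. (2) Let $(X_n)_{n\ge1}$ be independent, identically distributed real random variables with a continuous common distribution function, defined on an arbitrary probability space, and let the record times be given by $L_0=1$ and $L_{n+1}=\min\{j: X_j>X_{L_n},\ j>L_n\}$ for $n\ge0$. Almost surely these minima all exist, so that the sequence $(L_n)$ is well defined, and $\left(\frac{\log L_n-n}{n}\right)_{n\ge1}$ satisfies an LDP with speed $n$ and good rate function $I_C$. -/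

import Mathlib

open MeasureTheory ProbabilityTheory Filter

open scoped ENNReal NNReal

/-- A good rate function `I : ℝ → [0, ∞]`: lower semicontinuous with compact level sets. -/
structure IsGoodRateFunction (I : ℝ → ℝ≥0∞) : Prop where
  lowerSemicontinuous : LowerSemicontinuous I
  isCompact_levelSet : ∀ a : ℝ≥0, IsCompact {x : ℝ | I x ≤ (a : ℝ≥0∞)}

/-- The real random variables `Y n` satisfy a large deviation principle with speed `n` and good
rate function `I`. Everything is computed in the extended reals: `ENNReal.log 0 = ⊥`, and the
infimum over the empty set is `⊤`. -/
structure SatisfiesLDP {Ω : Type*} [MeasurableSpace Ω] (P : Measure Ω) (Y : ℕ → Ω → ℝ)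
    (I : ℝ → ℝ≥0∞) : Prop where
  aemeasurable : ∀ n, AEMeasurable (Y n) P
  good : IsGoodRateFunction I
  bounds : ∀ Γ : Set ℝ, MeasurableSet Γ →
    -(⨅ x ∈ interior Γ, (I x : EReal)) ≤
        liminf (fun n : ℕ => ((1 / (n : ℝ) : ℝ) : EReal) * ENNReal.log (P {ω | Y n ω ∈ Γ})) atTop ∧
      liminf (fun n : ℕ => ((1 / (n : ℝ) : ℝ) : EReal) * ENNReal.log (P {ω | Y n ω ∈ Γ})) atTop ≤
        limsup (fun n : ℕ => ((1 / (n : ℝ) : ℝ) : EReal) * ENNReal.log (P {ω | Y n ω ∈ Γ})) atTop ∧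
      limsup (fun n : ℕ => ((1 / (n : ℝ) : ℝ) : EReal) * ENNReal.log (P {ω | Y n ω ∈ Γ})) atTop ≤
        -(⨅ x ∈ closure Γ, (I x : EReal))

open Classical in
/-- The rate function `x - log (x + 1)` for `x > -1` (a nonnegative real number, so that
`ENNReal.ofReal` does not truncate it), and `∞` for `x ≤ -1`. -/
noncomputable def rateC (x : ℝ) : ℝ≥0∞ :=
  if -1 < x then ENNReal.ofReal (x - Real.log (x + 1)) else ⊤

/-- `d 1, d 2, …` are the digits of the modified Engel series of `x`:
`x = 1 / d₁ + 1 / ((d₁ - 1) d₂) + ⋯ + 1 / ((d₁ - 1) ⋯ (dₙ₋₁ - 1) dₙ) + ⋯`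
with `d₁ ≥ 2` and `dₙ₊₁ ≥ dₙ + 1`. The entry `d 0` does not occur in the series; it is fixed to
be `1`, so that the sequence is determined by `x`. -/
structure IsModifiedEngelSeries (d : ℕ → ℕ) (x : ℝ) : Prop where
  zero : d 0 = 1
  two_le : 2 ≤ d 1
  succ_le : ∀ n, 1 ≤ n → d n + 1 ≤ d (n + 1)
  hasSum : HasSum
    (fun n : ℕ => 1 / ((∏ i ∈ Finset.Icc 1 n, ((d i : ℝ) - 1)) * (d (n + 1) : ℝ))) x

/-- `L` is the sequence of record times of the real sequence `x 1, x 2, …`: `L 0 = 1`, and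
`L (n + 1)` is the least `j > L n` with `x j > x (L n)` (in particular such a `j` exists). -/
structure IsRecordTimes (x : ℕ+ → ℝ) (L : ℕ → ℕ+) : Prop where
  zero : L 0 = 1
  isLeast : ∀ n, IsLeast {j : ℕ+ | x j > x (L n) ∧ j > L n} (L (n + 1))

/-! The digits and the record times have the same one-dimensional laws, and only these laws matter.
Among i.i.d. variables with continuous law, the (m+1)-st is a record with probability 1/(m+1),
independently of the number of earlier records. The map x ↦ (d₁ - 1)(x - 1/d₁), affine on each set
of constant first digit, leads to the same recurrence for Lebesgue measure. In both cases p n m =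
P(D n ≤ m) satisfies `IsRecordArray`, and `satisfiesLDP_of_isRecordArray` needs nothing else.

After multiplication by m, both p and 1 - p obey the recurrence of the elementary symmetric
functions of 1, 1/2, 1/3, …. An upper bound comes from the generating product: s n m * θ^n is at
most ∏ (1 + θ/j), which is of order m^θ (`IsSymmArray.mul_pow_le`). For m ≈ exp(nb) the best choice
θ = 1/b gives exp(-n(b - 1 - log b)); the boundary values allow θ ≥ 1 for p (b ≤ 1) and θ ≤ 1 for 1
- p (b ≥ 1). The matching lower bound (log m - log n)^n / n! (`IsSymmArray.log_pow_le`) has the same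
exponent by Stirling's estimate. With b = a + 1 the exponent is a - log(a + 1).

These tail estimates give the full LDP because the rate is strictly monotone on each side of 0
(`satisfiesLDP_of_tails`). The recurrence is checked in `engelVolume_recurrence` for the digits. For
the records it comes from the factorisation of the joint law of record count and running maximum in
`measureReal_recordCount_lt`. -/

/-! ### Arrays with the recurrence of the Stirling numbers -/

/-- The product `(1 + θ) (1 + θ / 2) ⋯ (1 + θ / m)`. -/
noncomputable def risingProd (θ : ℝ) (m : ℕ) : ℝ := ∏ j ∈ Finset.range m, (1 + θ / ((j : ℝ) + 1))

/-- Arrays satisfying the recurrence of the elementary symmetric functions of `1, 1/2, 1/3, …`. -/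
def IsSymmArray (s : ℕ → ℕ → ℝ) : Prop :=
  ∀ n m, s (n + 1) (m + 1) = s (n + 1) m + s n m / ((m : ℝ) + 1)

lemma risingProd_succ (θ : ℝ) (m : ℕ) :
    risingProd θ (m + 1) = risingProd θ m * (1 + θ / ((m : ℝ) + 1)) :=
  Finset.prod_range_succ _ _

lemma risingProd_le_exp {θ : ℝ} (hθ : 0 ≤ θ) (m : ℕ) :
    risingProd θ m ≤ Real.exp (θ * (1 + Real.log ((m : ℝ) + 1))) := by
  have h1 : risingProd θ m ≤ Real.exp (θ * (harmonic m : ℝ)) := by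
    unfold risingProd harmonic
    push_cast
    rw [Finset.mul_sum, Real.exp_sum]
    refine Finset.prod_le_prod (fun j _ => by positivity) fun j _ => ?_
    have := Real.add_one_le_exp (θ * ((j : ℝ) + 1)⁻¹)
    rw [div_eq_mul_inv]
    linarith
  refine h1.trans (Real.exp_le_exp.2 (mul_le_mul_of_nonneg_left ?_ hθ))
  refine (harmonic_le_one_add_log m).trans ?_
  rcases Nat.eq_zero_or_pos m with rfl | hm
  · simp
  · have : Real.log (m : ℝ) ≤ Real.log ((m : ℝ) + 1) :=
      Real.log_le_log (by exact_mod_cast hm) (by linarith)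
    linarith

lemma add_one_le_risingProd {θ : ℝ} (hθ : 1 ≤ θ) (m : ℕ) : (m : ℝ) + 1 ≤ risingProd θ m := by
  induction m with
  | zero => simp [risingProd]
  | succ m ih =>
    rw [risingProd_succ]
    have h : 1 + 1 / ((m : ℝ) + 1) ≤ 1 + θ / ((m : ℝ) + 1) := by gcongr
    calc ((m + 1 : ℕ) : ℝ) + 1 = ((m : ℝ) + 1) * (1 + 1 / ((m : ℝ) + 1)) := by
          field_simp; push_cast; ring
      _ ≤ _ := mul_le_mul ih h (by positivity) (by linarith [(Nat.cast_nonneg m : (0 : ℝ) ≤ m)])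

/-- A single coefficient of a generating polynomial with nonnegative terms is at most its value at
θ. Induction along the recurrence replaces the polynomial, so only the boundary row and column have
to be controlled. -/
lemma IsSymmArray.mul_pow_le {s : ℕ → ℕ → ℝ} (hs : IsSymmArray s) {θ : ℝ} (hθ : 0 ≤ θ)
    (h0 : ∀ m, s 0 m ≤ risingProd θ m) (h1 : ∀ n, s (n + 1) 0 * θ ^ (n + 1) ≤ 1) (m n : ℕ) :
    s n m * θ ^ n ≤ risingProd θ m := by
  induction m generalizing n with
  | zero =>
    cases n with
    | zero => simpa using h0 0
    | succ n => simpa [risingProd] using h1 n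
  | succ m ih =>
    cases n with
    | zero => simpa using h0 (m + 1)
    | succ n =>
      rw [risingProd_succ, hs]
      have h2 : s n m * θ ^ n * (θ / ((m : ℝ) + 1)) ≤ risingProd θ m * (θ / ((m : ℝ) + 1)) :=
        mul_le_mul_of_nonneg_right (ih n) (by positivity)
      calc (s (n + 1) m + s n m / ((m : ℝ) + 1)) * θ ^ (n + 1)
          = s (n + 1) m * θ ^ (n + 1) + s n m * θ ^ n * (θ / ((m : ℝ) + 1)) := by
            rw [pow_succ]; ring
        _ ≤ _ := by linarith [ih (n + 1)]

lemma IsSymmArray.nonneg {s : ℕ → ℕ → ℝ} (hs : IsSymmArray s) (h0 : ∀ m, 1 ≤ s 0 m)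
    (h1 : ∀ n, 0 ≤ s (n + 1) 0) (m n : ℕ) : 0 ≤ s n m := by
  induction m generalizing n with
  | zero =>
    cases n with
    | zero => linarith [h0 0]
    | succ n => exact h1 n
  | succ m ih =>
    cases n with
    | zero => linarith [h0 (m + 1)]
    | succ n =>
      rw [hs]
      have := ih n
      have := ih (n + 1)
      positivity

lemma pow_succ_sub_le {x y : ℝ} (hy : 0 ≤ y) (hxy : y ≤ x) (n : ℕ) :
    x ^ (n + 1) ≤ y ^ (n + 1) + (n + 1) * (x - y) * x ^ n := by
  induction n with
  | zero => simp
  | succ n ih =>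
    have hx : 0 ≤ x := hy.trans hxy
    have h1 : y ^ (n + 1) ≤ x ^ (n + 1) := pow_le_pow_left₀ hy hxy _
    have h2 := mul_le_mul_of_nonneg_left h1 (sub_nonneg.2 hxy)
    have h3 := mul_le_mul_of_nonneg_left ih hx
    push_cast
    rw [pow_succ x (n + 1), pow_succ y (n + 1)]
    have h4 : x * (y ^ (n + 1) + (n + 1) * (x - y) * x ^ n)
      = x * y ^ (n + 1) + (n + 1) * (x - y) * x ^ (n + 1) := by ring
    nlinarith

/-- A discrete form of iterating the integral of dt/t. Increments of the logarithm are at most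
1/(m+1), and subtracting log(n+1) absorbs the error made in each row. -/
lemma IsSymmArray.log_pow_le {s : ℕ → ℕ → ℝ} (hs : IsSymmArray s) (h0 : ∀ m, 1 ≤ s 0 m)
    (h1 : ∀ n, 0 ≤ s (n + 1) 0) (m n : ℕ) (hn : n ≤ m) :
    (Real.log ((m : ℝ) + 1) - Real.log ((n : ℝ) + 1)) ^ n / (n.factorial : ℝ) ≤ s n m := by
  induction m generalizing n with
  | zero =>
    obtain rfl : n = 0 := by omega
    simpa using h0 0
  | succ m ih =>
    cases n with
    | zero => simpa using h0 (m + 1)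
    | succ n =>
      -- On the diagonal the difference of logarithms vanishes and nonnegativity is enough.
      rcases hn.eq_or_lt with h | h
      · obtain rfl : n = m := by omega
        simpa using hs.nonneg h0 h1 (n + 1) (n + 1)
      · have hnm : n + 1 ≤ m := by omega
        rw [hs]
        have e1 := ih (n + 1) hnm
        have e2 := ih n (by omega)
        push_cast at e1 ⊢
        set x := Real.log ((m : ℝ) + 1 + 1) - Real.log ((n : ℝ) + 1 + 1) with hx
        set y := Real.log ((m : ℝ) + 1) - Real.log ((n : ℝ) + 1 + 1) with hy
        set z := Real.log ((m : ℝ) + 1) - Real.log ((n : ℝ) + 1) with hz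
        have hm0 : (0 : ℝ) ≤ m := Nat.cast_nonneg m
        have hn0 : (0 : ℝ) ≤ n := Nat.cast_nonneg n
        have hnm' : (n : ℝ) + 1 ≤ m := by exact_mod_cast hnm
        have y0 : 0 ≤ y := sub_nonneg.2 (Real.log_le_log (by positivity) (by linarith))
        have hlog (a : ℝ) (ha : 0 ≤ a) :
            Real.log (a + 1 + 1) - Real.log (a + 1) = Real.log (1 + 1 / (a + 1)) := by
          rw [← Real.log_div (by positivity) (by positivity)]
          congr 1
          field_simp
        have hxy : y ≤ x := by
          have := Real.log_le_log (by positivity : (0 : ℝ) < m + 1)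
            (by linarith : (m : ℝ) + 1 ≤ m + 1 + 1)
          linarith
        have hxy1 : x - y ≤ 1 / ((m : ℝ) + 1) := by
          have := Real.log_le_sub_one_of_pos (by positivity : 0 < 1 + 1 / ((m : ℝ) + 1))
          have := hlog m hm0
          linarith
        -- log(1 + 1/t) decreases in t, so raising both arguments by one shrinks the difference of
        -- logarithms.
        have hxz : x ≤ z := by
          have h3 := hlog m hm0
          have h4 := hlog n hn0
          have h5 : Real.log (1 + 1 / ((m : ℝ) + 1)) ≤ Real.log (1 + 1 / ((n : ℝ) + 1)) := by
            apply Real.log_le_log (by positivity)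
            gcongr
            linarith
          linarith
        have hx0 : 0 ≤ x := y0.trans hxy
        have hzp : x ^ n ≤ z ^ n := pow_le_pow_left₀ hx0 hxz n
        have key := pow_succ_sub_le y0 hxy n
        have hf : (0 : ℝ) < (n.factorial : ℝ) := by positivity
        have h6 : ((n : ℝ) + 1) * (x - y) * x ^ n ≤
            ((n : ℝ) + 1) * (1 / ((m : ℝ) + 1)) * z ^ n := by gcongr
        have h7 : x ^ (n + 1) / ((n + 1).factorial : ℝ) ≤
            y ^ (n + 1) / ((n + 1).factorial : ℝ) + z ^ n / (n.factorial : ℝ) / ((m : ℝ) + 1) := by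
          have : z ^ n / (n.factorial : ℝ) / ((m : ℝ) + 1) =
              (((n : ℝ) + 1) * (1 / ((m : ℝ) + 1)) * z ^ n) / ((n + 1).factorial : ℝ) := by
            rw [Nat.factorial_succ]; push_cast; field_simp
          rw [this, ← add_div]
          gcongr
          linarith
        have h8 : z ^ n / (n.factorial : ℝ) / ((m : ℝ) + 1) ≤ s n m / ((m : ℝ) + 1) := by gcongr
        linarith

/-- The recurrence satisfied by the distribution functions `p n m = P(D n ≤ m)`. -/
structure IsRecordArray (p : ℕ → ℕ → ℝ) : Prop where
  zero : ∀ m : ℕ, 1 ≤ m → p 0 m = 1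
  one : ∀ n, p (n + 1) 1 = 0
  succ : ∀ n m : ℕ, 1 ≤ m → ((m : ℝ) + 1) * p (n + 1) (m + 1) = m * p (n + 1) m + p n m

/-! ### Tail bounds for record arrays -/

namespace IsRecordArray

variable {p : ℕ → ℕ → ℝ}

lemma succ' (hp : IsRecordArray p) (n m : ℕ) : ((m : ℝ) + 1 + 1) * p (n + 1) (m + 1 + 1) =
    ((m : ℝ) + 1) * p (n + 1) (m + 1) + p n (m + 1) := by
  have := hp.succ n (m + 1) (by omega)
  push_cast at this
  exact this

lemma isSymmArray (hp : IsRecordArray p) :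
    IsSymmArray fun n m => ((m : ℝ) + 1) * p n (m + 1) := by
  intro n m
  have h := hp.succ' n m
  push_cast
  rw [h]
  field_simp

/-- The recurrence is linear and m + 1 itself solves it, so the complement inherits it. -/
lemma isSymmArray_compl (hp : IsRecordArray p) :
    IsSymmArray fun n m => ((m : ℝ) + 1) * (1 - p n (m + 1)) := by
  intro n m
  have h := hp.succ' n m
  push_cast
  rw [mul_sub, h]
  field_simp
  ring

lemma one_eq (hp : IsRecordArray p) (m : ℕ) : ((m : ℝ) + 1) * (1 - p 1 (m + 1)) = 1 := by
  induction m with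
  | zero => simp [hp.one 0]
  | succ m ih =>
    have h := hp.succ' 0 m
    rw [hp.zero (m + 1) (by omega)] at h
    push_cast
    simp only [zero_add] at h
    linarith

lemma le_exp (hp : IsRecordArray p) {θ : ℝ} (hθ : 1 ≤ θ) {m : ℕ} (hm : 1 ≤ m) (n : ℕ) :
    p n m ≤ Real.exp (θ * (1 + Real.log m) - Real.log m - n * Real.log θ) := by
  obtain ⟨m, rfl⟩ : ∃ k, m = k + 1 := ⟨m - 1, by omega⟩
  have h := hp.isSymmArray.mul_pow_le (by linarith : 0 ≤ θ)
    -- Row zero equals m + 1, which the product dominates only because θ ≥ 1.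
    (fun m => by simpa [hp.zero (m + 1) (by omega)] using add_one_le_risingProd hθ m)
    (fun n => by simp [hp.one]) m n
  have h2 := h.trans (risingProd_le_exp (by linarith : 0 ≤ θ) m)
  have hθ0 : 0 < θ := by linarith
  have hm0 : (0 : ℝ) < (m : ℝ) + 1 := by positivity
  rw [Real.exp_sub, Real.exp_sub, Real.exp_nat_mul, Real.exp_log hθ0]
  push_cast
  rw [Real.exp_log hm0, div_div, le_div_iff₀ (by positivity)]
  linarith

lemma compl_le_exp (hp : IsRecordArray p) {θ : ℝ} (hθ0 : 0 < θ) (hθ : θ ≤ 1) {m : ℕ} (hm : 1 ≤ m)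
    (n : ℕ) : 1 - p n m ≤ Real.exp (θ * (1 + Real.log m) - Real.log m - n * Real.log θ) := by
  obtain ⟨m, rfl⟩ : ∃ k, m = k + 1 := ⟨m - 1, by omega⟩
  have h := hp.isSymmArray_compl.mul_pow_le hθ0.le
    (fun m => by
      simp only [hp.zero (m + 1) (by omega), sub_self, mul_zero]
      exact Finset.prod_nonneg fun j _ => by positivity)
    (fun n => by
      simp only [hp.one, CharP.cast_eq_zero, zero_add, sub_zero, one_mul]
      exact pow_le_one₀ hθ0.le hθ) m n
  have h2 := h.trans (risingProd_le_exp hθ0.le m)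
  have hm0 : (0 : ℝ) < (m : ℝ) + 1 := by positivity
  rw [Real.exp_sub, Real.exp_sub, Real.exp_nat_mul, Real.exp_log hθ0]
  push_cast
  rw [Real.exp_log hm0, div_div, le_div_iff₀ (by positivity)]
  linarith

lemma log_pow_le (hp : IsRecordArray p) {n m : ℕ} (hm : n + 1 ≤ m) :
    (Real.log m - Real.log (n + 1)) ^ n / (n.factorial : ℝ) / m ≤ p n m := by
  obtain ⟨m, rfl⟩ : ∃ k, m = k + 1 := ⟨m - 1, by omega⟩
  have h := hp.isSymmArray.log_pow_le
    (fun m => by simp [hp.zero (m + 1) (by omega)])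
    (fun n => by simp [hp.one]) m n (by omega)
  push_cast
  rw [div_le_iff₀ (by positivity)]
  linarith

/-- Row zero of the complementary array vanishes, so the lower bound is applied after dropping it:
the next row is constantly 1 by `one_eq`. This shifts n by one. -/
lemma log_pow_le_compl (hp : IsRecordArray p) {n m : ℕ} (hm : n + 1 ≤ m) :
    (Real.log m - Real.log (n + 1)) ^ n / (n.factorial : ℝ) / m ≤ 1 - p (n + 1) m := by
  obtain ⟨m, rfl⟩ : ∃ k, m = k + 1 := ⟨m - 1, by omega⟩
  have h := IsSymmArray.log_pow_le (s := fun n m => ((m : ℝ) + 1) * (1 - p (n + 1) (m + 1)))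
    (fun n m => hp.isSymmArray_compl (n + 1) m)
    (fun m => (hp.one_eq m).ge)
    (fun n => by simp [hp.one]) m n (by omega)
  push_cast
  rw [div_le_iff₀ (by positivity)]
  linarith

end IsRecordArray

/-! ### Exponential asymptotics of the tails -/

lemma log_factorial_le (n : ℕ) (hn : 1 ≤ n) :
    Real.log (n.factorial : ℝ) ≤ n * Real.log n - n + Real.log n + 1 := by
  induction n, hn using Nat.le_induction with
  | base => simp
  | succ n hn ih =>
    have hn0 : (0 : ℝ) < n := by exact_mod_cast hn
    rw [Nat.factorial_succ]
    push_cast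
    rw [Real.log_mul (by positivity) (by positivity)]
    have h1 := Real.log_le_sub_one_of_pos (by positivity : (0 : ℝ) < n / (n + 1))
    rw [Real.log_div (by positivity) (by positivity)] at h1
    have h2 : (n : ℝ) / (n + 1) - 1 = -(1 / (n + 1)) := by field_simp; ring
    rw [h2] at h1
    have h3 := mul_le_mul_of_nonneg_left h1 (by positivity : (0 : ℝ) ≤ n + 1)
    have h4 : ((n : ℝ) + 1) * -(1 / (n + 1)) = -1 := by field_simp
    rw [h4] at h3
    nlinarith

lemma tendsto_log_natCast_div : Tendsto (fun n : ℕ => Real.log n / (n : ℝ)) atTop (nhds 0) := by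
  have h := (Real.isLittleO_log_id_atTop.comp_tendsto tendsto_natCast_atTop_atTop).tendsto_div_nhds_zero
  simpa [Function.comp_def] using h

lemma tendsto_log_add_one_div :
    Tendsto (fun n : ℕ => Real.log ((n : ℝ) + 1) / (n : ℝ)) atTop (nhds 0) := by
  have h2 := tendsto_log_natCast_div.add
    ((tendsto_const_nhds (x := Real.log 2)).div_atTop tendsto_natCast_atTop_atTop)
  rw [add_zero] at h2
  refine squeeze_zero' (Eventually.of_forall fun n => ?_) ?_ h2
  · exact div_nonneg (Real.log_nonneg (by linarith [(Nat.cast_nonneg n : (0 : ℝ) ≤ n)]))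
      (Nat.cast_nonneg n)
  · filter_upwards [eventually_ge_atTop 1] with n hn
    have hn' : (1 : ℝ) ≤ n := by exact_mod_cast hn
    rw [← add_div, ← Real.log_mul (by positivity) (by norm_num)]
    gcongr
    linarith

section Tails

variable {p : ℕ → ℕ → ℝ} {m : ℕ → ℕ} {b ε : ℝ}

/-- The value θ = b⁻¹ minimises θb - b - log θ, the limit of the exponent divided by n; the minimum
is -(b - 1 - log b). -/
lemma eventually_exponent_le (hb : 0 < b) (hε : 0 < ε)
    (hlim : Tendsto (fun n : ℕ => Real.log (m n) / (n : ℝ)) atTop (nhds b)) :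
    ∀ᶠ n : ℕ in atTop, Real.exp (b⁻¹ * (1 + Real.log (m n)) - Real.log (m n) - n * Real.log b⁻¹) ≤
      Real.exp (-(n * (b - 1 - Real.log b - ε))) := by
  have h1 : Tendsto (fun n : ℕ => b⁻¹ / (n : ℝ) + (b⁻¹ - 1) * (Real.log (m n) / (n : ℝ)) +
      Real.log b) atTop (nhds (0 + (b⁻¹ - 1) * b + Real.log b)) :=
    (((tendsto_const_nhds).div_atTop tendsto_natCast_atTop_atTop).add
      (hlim.const_mul _)).add_const _
  have h2 : 0 + (b⁻¹ - 1) * b + Real.log b < -(b - 1 - Real.log b - ε) := by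
    have : b⁻¹ * b = 1 := inv_mul_cancel₀ hb.ne'
    linarith
  filter_upwards [h1.eventually_lt_const h2, eventually_ge_atTop 1] with n hn hn1
  have hn0 : (0 : ℝ) < n := by exact_mod_cast hn1
  apply Real.exp_le_exp.2
  have h3 := mul_le_mul_of_nonneg_left hn.le hn0.le
  have h4 : (n : ℝ) * (b⁻¹ / (n : ℝ) + (b⁻¹ - 1) * (Real.log (m n) / (n : ℝ)) + Real.log b) =
      b⁻¹ * (1 + Real.log (m n)) - Real.log (m n) - n * Real.log b⁻¹ := by
    rw [Real.log_inv]; field_simp; ring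
  rw [h4] at h3
  linarith

lemma eventually_exp_le_log_pow (hb : 0 < b) (hε : 0 < ε)
    (hlim : Tendsto (fun n : ℕ => Real.log (m n) / (n : ℝ)) atTop (nhds b)) :
    ∀ᶠ n : ℕ in atTop, n + 1 ≤ m n ∧ Real.exp (-(n * (b - 1 - Real.log b + ε))) ≤
      (Real.log (m n) - Real.log (n + 1)) ^ n / (n.factorial : ℝ) / m n := by
  have h1 : Tendsto (fun n : ℕ => Real.log (m n) / (n : ℝ) - Real.log ((n : ℝ) + 1) / (n : ℝ))
      atTop (nhds b) := by simpa using hlim.sub tendsto_log_add_one_div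
  have h2 : Tendsto (fun n : ℕ => Real.log (Real.log (m n) / (n : ℝ) -
      Real.log ((n : ℝ) + 1) / (n : ℝ)) + 1 - Real.log n / (n : ℝ) - 1 / (n : ℝ) -
      Real.log (m n) / (n : ℝ)) atTop (nhds (Real.log b + 1 - 0 - 0 - b)) :=
    ((((h1.log hb.ne').add_const 1).sub tendsto_log_natCast_div).sub
      (tendsto_const_nhds.div_atTop tendsto_natCast_atTop_atTop)).sub hlim
  have h3 : -(b - 1 - Real.log b + ε) < Real.log b + 1 - 0 - 0 - b := by linarith
  filter_upwards [h1.eventually_const_lt hb, h2.eventually_const_lt h3, eventually_ge_atTop 1]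
    with n hn1 hn2 hn3
  have hn0 : (0 : ℝ) < n := by exact_mod_cast hn3
  rw [← sub_div] at hn1 hn2
  have hpos : 0 < Real.log (m n) - Real.log (n + 1) := by
    by_contra hcon
    exact absurd hn1 (not_lt.2 (div_nonpos_of_nonpos_of_nonneg (not_lt.1 hcon) hn0.le))
  have hlogn : 0 ≤ Real.log ((n : ℝ) + 1) := Real.log_nonneg (by linarith)
  have hm0 : 0 < m n := by
    rcases Nat.eq_zero_or_pos (m n) with h | h
    · rw [h] at hpos; simp at hpos; linarith
    · exact h
  have hm0' : (0 : ℝ) < m n := by exact_mod_cast hm0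
  refine ⟨?_, ?_⟩
  · have := (Real.log_lt_log_iff (by positivity) hm0').1 (sub_pos.1 hpos)
    exact_mod_cast this.le
  · have e : (Real.log (m n) - Real.log (n + 1)) ^ n / (n.factorial : ℝ) / m n =
        Real.exp (n * Real.log (Real.log (m n) - Real.log (n + 1)) - Real.log (n.factorial : ℝ) -
          Real.log (m n)) := by
      rw [Real.exp_sub, Real.exp_sub, Real.exp_nat_mul, Real.exp_log hpos,
        Real.exp_log (by positivity), Real.exp_log hm0']
    rw [e]
    apply Real.exp_le_exp.2
    have h4 := mul_le_mul_of_nonneg_left hn2.le hn0.le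
    rw [Real.log_div hpos.ne' hn0.ne'] at h4
    have h5 : (n : ℝ) * (Real.log (Real.log (m n) - Real.log (n + 1)) - Real.log n + 1 -
        Real.log n / (n : ℝ) - 1 / (n : ℝ) - Real.log (m n) / (n : ℝ)) =
        n * Real.log (Real.log (m n) - Real.log (n + 1)) - (n * Real.log n - n + Real.log n + 1) -
          Real.log (m n) := by
      field_simp; ring
    rw [h5] at h4
    have := log_factorial_le n hn3
    linarith

lemma IsRecordArray.eventually_le (hp : IsRecordArray p) (hb : 0 < b) (hb1 : b ≤ 1) (hε : 0 < ε)
    (hm : ∀ᶠ n in atTop, 1 ≤ m n)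
    (hlim : Tendsto (fun n : ℕ => Real.log (m n) / (n : ℝ)) atTop (nhds b)) :
    ∀ᶠ n : ℕ in atTop, p n (m n) ≤ Real.exp (-(n * (b - 1 - Real.log b - ε))) := by
  filter_upwards [hm, eventually_exponent_le hb hε hlim] with n h1 h2
  exact (hp.le_exp ((one_le_inv₀ hb).2 hb1) h1 n).trans h2

lemma IsRecordArray.eventually_compl_le (hp : IsRecordArray p) (hb1 : 1 ≤ b) (hε : 0 < ε)
    (hm : ∀ᶠ n in atTop, 1 ≤ m n)
    (hlim : Tendsto (fun n : ℕ => Real.log (m n) / (n : ℝ)) atTop (nhds b)) :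
    ∀ᶠ n : ℕ in atTop, 1 - p n (m n) ≤ Real.exp (-(n * (b - 1 - Real.log b - ε))) := by
  have hb : 0 < b := by linarith
  filter_upwards [hm, eventually_exponent_le hb hε hlim] with n h1 h2
  exact (hp.compl_le_exp (inv_pos.2 hb) (inv_le_one_of_one_le₀ hb1) h1 n).trans h2

lemma IsRecordArray.eventually_ge (hp : IsRecordArray p) (hb : 0 < b) (hε : 0 < ε)
    (hlim : Tendsto (fun n : ℕ => Real.log (m n) / (n : ℝ)) atTop (nhds b)) :
    ∀ᶠ n : ℕ in atTop, Real.exp (-(n * (b - 1 - Real.log b + ε))) ≤ p n (m n) := by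
  filter_upwards [eventually_exp_le_log_pow hb hε hlim] with n h
  exact h.2.trans (hp.log_pow_le h.1)

/-- The bound for row n + 1 involves the power n. Replacing n by n + 1 changes neither the limit b
nor, since b - 1 - log b ≥ 0, the direction of the estimate. -/
lemma IsRecordArray.eventually_compl_ge (hp : IsRecordArray p) (hb : 0 < b) (hε : 0 < ε)
    (hlim : Tendsto (fun n : ℕ => Real.log (m n) / (n : ℝ)) atTop (nhds b)) :
    ∀ᶠ n : ℕ in atTop, Real.exp (-(n * (b - 1 - Real.log b + ε))) ≤ 1 - p n (m n) := by
  have h1 : Tendsto (fun n : ℕ => Real.log (m (n + 1)) / (n : ℝ)) atTop (nhds b) := by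
    have h2 := (tendsto_add_atTop_iff_nat 1).2 hlim
    have h3 : Tendsto (fun n : ℕ => (((n + 1 : ℕ) : ℝ)) / (n : ℝ)) atTop (nhds 1) := by
      have : Tendsto (fun n : ℕ => 1 + 1 / (n : ℝ)) atTop (nhds (1 + 0)) :=
        tendsto_const_nhds.add (tendsto_const_nhds.div_atTop tendsto_natCast_atTop_atTop)
      rw [add_zero] at this
      refine this.congr' ?_
      filter_upwards [eventually_ge_atTop 1] with n hn
      have hn0 : (0 : ℝ) < n := by exact_mod_cast hn
      push_cast
      field_simp
    have h4 := h2.mul h3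
    rw [mul_one] at h4
    refine h4.congr fun n => ?_
    have : ((n + 1 : ℕ) : ℝ) ≠ 0 := by positivity
    field_simp
  have h5 := eventually_exp_le_log_pow hb hε h1
  rw [← map_add_atTop_eq_nat 1, eventually_map]
  filter_upwards [h5] with n h
  refine le_trans (Real.exp_le_exp.2 ?_) (h.2.trans (hp.log_pow_le_compl h.1))
  have := Real.log_le_sub_one_of_pos hb
  push_cast
  nlinarith

end Tails

/-! ### The rate function -/

lemma rateC_of_lt {x : ℝ} (hx : -1 < x) : rateC x = ENNReal.ofReal (x - Real.log (x + 1)) :=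
  if_pos hx

lemma sub_log_nonneg {x : ℝ} (hx : -1 < x) : 0 ≤ x - Real.log (x + 1) := by
  have := Real.log_le_sub_one_of_pos (by linarith : 0 < x + 1)
  linarith

lemma coe_rateC_of_lt {x : ℝ} (hx : -1 < x) :
    ((rateC x : ℝ≥0∞) : EReal) = ((x - Real.log (x + 1) : ℝ) : EReal) := by
  rw [rateC_of_lt hx, EReal.coe_ennreal_ofReal, max_eq_left (sub_log_nonneg hx)]

/-- The last hypothesis says that b lies beyond x as seen from 0, which treats both monotone
branches at once. The tangent to the logarithm at x + 1 gives the inequality. -/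
lemma sub_log_lt_sub_log {x b : ℝ} (hx : -1 < x) (hb : -1 < b) (hxb : b ≠ x)
    (h : 0 ≤ (b - x) * x) : x - Real.log (x + 1) < b - Real.log (b + 1) := by
  have hx1 : 0 < x + 1 := by linarith
  have hb1 : 0 < b + 1 := by linarith
  have h1 := Real.log_lt_sub_one_of_pos (div_pos hb1 hx1)
    (by rw [Ne, div_eq_one_iff_eq hx1.ne']; intro h; exact hxb (by linarith))
  rw [Real.log_div hb1.ne' hx1.ne'] at h1
  have h2 : (b + 1) / (x + 1) - 1 = (b - x) - (b - x) * x / (x + 1) := by field_simp; ring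
  have h3 : 0 ≤ (b - x) * x / (x + 1) := by positivity
  linarith

lemma sub_log_le_sub_log {x b : ℝ} (hx : -1 < x) (hb : -1 < b)
    (h : 0 ≤ (b - x) * x) : x - Real.log (x + 1) ≤ b - Real.log (b + 1) := by
  rcases eq_or_ne b x with rfl | hxb
  · exact le_rfl
  · exact (sub_log_lt_sub_log hx hb hxb h).le

lemma le_of_sub_log_le {x a : ℝ} (hx : -1 < x) (h : x - Real.log (x + 1) ≤ a) :
    Real.exp (-(a + 1)) - 1 ≤ x ∧ x ≤ 2 * a + 1 := by
  have hx1 : 0 < x + 1 := by linarith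
  constructor
  · have : Real.exp (-(a + 1)) ≤ x + 1 := by
      rw [← Real.le_log_iff_exp_le hx1]; linarith
    linarith
  · have h1 := Real.log_le_sub_one_of_pos (by linarith : 0 < (x + 1) / 2)
    rw [Real.log_div hx1.ne' (by norm_num)] at h1
    have h2 := Real.log_le_sub_one_of_pos (by norm_num : (0 : ℝ) < 2)
    linarith

lemma continuousOn_sub_log : ContinuousOn (fun x : ℝ => x - Real.log (x + 1)) (Set.Ioi (-1)) := by
  refine continuousOn_id.sub (ContinuousOn.log (by fun_prop) fun x hx => ?_)
  have : -1 < x := hx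
  linarith

lemma isCompact_levelSet_rateC (a : ℝ≥0) : IsCompact {x : ℝ | rateC x ≤ (a : ℝ≥0∞)} := by
  have hsub : Set.Icc (Real.exp (-((a : ℝ) + 1)) - 1) (2 * (a : ℝ) + 1) ⊆ Set.Ioi (-1) := by
    intro x hx
    have := Real.exp_pos (-((a : ℝ) + 1))
    have := hx.1
    simp only [Set.mem_Ioi]; linarith
  have h : {x : ℝ | rateC x ≤ (a : ℝ≥0∞)} =
      Set.Icc (Real.exp (-((a : ℝ) + 1)) - 1) (2 * (a : ℝ) + 1) ∩
        (fun x : ℝ => x - Real.log (x + 1)) ⁻¹' Set.Iic (a : ℝ) := by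
    ext x
    have key (hx : -1 < x) : rateC x ≤ (a : ℝ≥0∞) ↔ x - Real.log (x + 1) ≤ a := by
      rw [rateC_of_lt hx, ← ENNReal.ofReal_coe_nnreal, ENNReal.ofReal_le_ofReal_iff a.coe_nonneg]
    constructor
    · intro hx
      have hx1 : -1 < x := by
        by_contra hcon
        simp [rateC, hcon] at hx
      have h1 := (key hx1).1 hx
      exact ⟨le_of_sub_log_le hx1 h1, h1⟩
    · rintro ⟨h1, h2⟩
      exact (key (hsub h1)).2 h2
  rw [h]
  exact isCompact_Icc.of_isClosed_subset
    ((continuousOn_sub_log.mono hsub).preimage_isClosed_of_isClosed isClosed_Icc isClosed_Iic)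
    Set.inter_subset_left

lemma isGoodRateFunction_rateC : IsGoodRateFunction rateC where
  lowerSemicontinuous := by
    rw [lowerSemicontinuous_iff_isClosed_preimage]
    intro y
    induction y with
    | top => simp
    | coe a => exact (isCompact_levelSet_rateC a).isClosed
  isCompact_levelSet := isCompact_levelSet_rateC

lemma exists_sub_log_eq {c : ℝ} (hc : 0 < c) :
    (∃ v, 0 < v ∧ v - Real.log (v + 1) = c) ∧ ∃ u, -1 < u ∧ u < 0 ∧ u - Real.log (u + 1) = c := by
  -- The point 2c + 2 lies beyond the bound 2c + 1 of the level set in `le_of_sub_log_le`.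
  have hv : c ≤ (2 * c + 2) - Real.log ((2 * c + 2) + 1) := by
    by_contra hcon
    have := (le_of_sub_log_le (by linarith) (not_le.1 hcon).le).2
    linarith
  have hu1 : -1 < Real.exp (-(c + 2)) - 1 := by linarith [Real.exp_pos (-(c + 2))]
  have hu0 : Real.exp (-(c + 2)) - 1 ≤ 0 := by
    have : Real.exp (-(c + 2)) ≤ 1 := Real.exp_le_one_iff.2 (by linarith)
    linarith
  have hu : c ≤ (Real.exp (-(c + 2)) - 1) - Real.log ((Real.exp (-(c + 2)) - 1) + 1) := by
    rw [sub_add_cancel, Real.log_exp]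
    linarith [Real.exp_pos (-(c + 2))]
  constructor
  · obtain ⟨v, hv1, hv2⟩ := intermediate_value_Icc (by linarith : (0 : ℝ) ≤ 2 * c + 2)
      (continuousOn_sub_log.mono fun x hx => by
        have := hx.1; simp only [Set.mem_Ioi]; linarith)
      (show c ∈ Set.Icc _ _ from ⟨by simpa using hc.le, hv⟩)
    refine ⟨v, lt_of_le_of_ne hv1.1 ?_, hv2⟩
    rintro rfl
    simp at hv2
    linarith
  · obtain ⟨v, hv1, hv2⟩ := intermediate_value_Icc' hu0
      (continuousOn_sub_log.mono fun x hx => by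
        have := hx.1; simp only [Set.mem_Ioi]; linarith)
      (show c ∈ Set.Icc _ _ from ⟨by simpa using hc.le, hu⟩)
    refine ⟨v, hu1.trans_le hv1.1, lt_of_le_of_ne hv1.2 ?_, hv2⟩
    rintro rfl
    simp at hv2
    linarith

/-! ### From tails to the large deviation principle -/

section LDP

variable {Ω : Type*} [MeasurableSpace Ω] {P : Measure Ω} [IsProbabilityMeasure P]

lemma div_mul_log_le {A : Set Ω} {n : ℕ} (hn : 1 ≤ n) {c : ℝ}
    (h : P.real A ≤ Real.exp (-(n * c))) :
    ((1 / (n : ℝ) : ℝ) : EReal) * ENNReal.log (P A) ≤ ((-c : ℝ) : EReal) := by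
  have hn0 : (0 : ℝ) < n := by exact_mod_cast hn
  have h1 : ENNReal.log (P A) ≤ ((-(n * c) : ℝ) : EReal) := by
    rw [← Real.log_exp (-(n * c)), ← ENNReal.log_ofReal_of_pos (Real.exp_pos _)]
    apply ENNReal.log_monotone
    rw [← ofReal_measureReal]
    exact ENNReal.ofReal_le_ofReal h
  calc ((1 / (n : ℝ) : ℝ) : EReal) * ENNReal.log (P A)
      ≤ ((1 / (n : ℝ) : ℝ) : EReal) * ((-(n * c) : ℝ) : EReal) :=
        mul_le_mul_of_nonneg_left h1 (by exact_mod_cast (by positivity : (0 : ℝ) ≤ 1 / (n : ℝ)))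
    _ = _ := by rw [← EReal.coe_mul]; congr 1; field_simp

lemma le_div_mul_log {A : Set Ω} {n : ℕ} (hn : 1 ≤ n) {c : ℝ}
    (h : Real.exp (-(n * c)) ≤ P.real A) :
    ((-c : ℝ) : EReal) ≤ ((1 / (n : ℝ) : ℝ) : EReal) * ENNReal.log (P A) := by
  have hn0 : (0 : ℝ) < n := by exact_mod_cast hn
  have h1 : ((-(n * c) : ℝ) : EReal) ≤ ENNReal.log (P A) := by
    rw [← Real.log_exp (-(n * c)), ← ENNReal.log_ofReal_of_pos (Real.exp_pos _)]
    apply ENNReal.log_monotone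
    rw [← ofReal_measureReal]
    exact ENNReal.ofReal_le_ofReal h
  calc ((-c : ℝ) : EReal) = ((1 / (n : ℝ) : ℝ) : EReal) * ((-(n * c) : ℝ) : EReal) := by
        rw [← EReal.coe_mul]; congr 1; field_simp
    _ ≤ _ := mul_le_mul_of_nonneg_left h1
        (by exact_mod_cast (by positivity : (0 : ℝ) ≤ 1 / (n : ℝ)))

lemma div_mul_log_nonpos (A : Set Ω) (n : ℕ) :
    ((1 / (n : ℝ) : ℝ) : EReal) * ENNReal.log (P A) ≤ 0 := by
  have h1 : ENNReal.log (P A) ≤ 0 := ENNReal.log_le_zero_iff.2 prob_le_one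
  have := mul_le_mul_of_nonneg_left h1
    (by exact_mod_cast (by positivity : (0 : ℝ) ≤ 1 / (n : ℝ)) :
      (0 : EReal) ≤ ((1 / (n : ℝ) : ℝ) : EReal))
  simpa using this

lemma eventually_exp_sub_exp {s t ε : ℝ} (hε : 0 < ε) (h : s + 2 * ε ≤ t) :
    ∀ᶠ n : ℕ in atTop, Real.exp (-(n * (s + ε))) ≤ Real.exp (-(n * s)) - Real.exp (-(n * t)) := by
  have h1 : ∀ᶠ n : ℕ in atTop, Real.log 2 ≤ n * ε :=
    (tendsto_natCast_atTop_atTop.atTop_mul_const hε).eventually_ge_atTop _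
  filter_upwards [h1] with n hn
  have h2 : Real.exp (-(n * ε)) ≤ 1 / 2 := by
    rw [Real.exp_neg, one_div]
    apply inv_anti₀ (by norm_num)
    rwa [← Real.log_le_iff_le_exp (by norm_num)]
  have h3 : Real.exp (-(n * t)) ≤ Real.exp (-(n * s)) * Real.exp (-(n * ε)) := by
    rw [← Real.exp_add]
    apply Real.exp_le_exp.2
    have h4 : (n : ℝ) * (s + 2 * ε) ≤ n * t := by gcongr
    have : 0 ≤ (n : ℝ) * ε := by positivity
    linarith
  have h5 : Real.exp (-(n * (s + ε))) = Real.exp (-(n * s)) * Real.exp (-(n * ε)) := by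
    rw [← Real.exp_add]; congr 1; ring
  have := Real.exp_pos (-(n * s))
  rw [h5]
  nlinarith

/-- If the upper and lower tails of `Y n` decay exponentially with rate `x - log (x + 1)`, then
`Y n` satisfies the large deviation principle with rate function `rateC`. -/
theorem satisfiesLDP_of_tails {Y : ℕ → Ω → ℝ} (hY : ∀ n, AEMeasurable (Y n) P)
    (upper_le : ∀ a, 0 < a → ∀ ε, 0 < ε → ∀ᶠ n : ℕ in atTop,
      P.real {ω | a ≤ Y n ω} ≤ Real.exp (-(n * (a - Real.log (a + 1) - ε))))
    (lower_le : ∀ a, -1 < a → a < 0 → ∀ ε, 0 < ε → ∀ᶠ n : ℕ in atTop,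
      P.real {ω | Y n ω < a} ≤ Real.exp (-(n * (a - Real.log (a + 1) - ε))))
    (le_upper : ∀ a, 0 ≤ a → ∀ ε, 0 < ε → ∀ᶠ n : ℕ in atTop,
      Real.exp (-(n * (a - Real.log (a + 1) + ε))) ≤ P.real {ω | a ≤ Y n ω})
    (le_lower : ∀ a, -1 < a → a ≤ 0 → ∀ ε, 0 < ε → ∀ᶠ n : ℕ in atTop,
      Real.exp (-(n * (a - Real.log (a + 1) + ε))) ≤ P.real {ω | Y n ω < a}) :
    SatisfiesLDP P Y rateC where
  aemeasurable := hY
  good := isGoodRateFunction_rateC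
  bounds := by
    intro Γ hΓ
    refine ⟨?_, liminf_le_limsup, ?_⟩
    · rw [EReal.neg_le]
      refine le_iInf₂ fun x hx => ?_
      rw [EReal.neg_le]
      by_cases hx1 : -1 < x
      swap
      · simp [rateC, hx1]
      rw [coe_rateC_of_lt hx1]
      set R : ℝ → ℝ := fun x => x - Real.log (x + 1) with hR
      -- it suffices to bound the probability from below by `exp (-n (R x + η))`
      suffices H : ∀ η₀ > 0, ∃ η, 0 < η ∧ η ≤ η₀ ∧ ∀ᶠ n : ℕ in atTop,
          Real.exp (-(n * (R x + η))) ≤ P.real {ω | Y n ω ∈ Γ} by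
        apply le_of_forall_lt
        intro c hc
        obtain ⟨c', hc1, hc2⟩ := EReal.lt_iff_exists_real_btwn.1 hc
        have hc3 : c' < -R x := by
          rw [← EReal.coe_neg] at hc2
          exact_mod_cast hc2
        obtain ⟨η, _, hη1, hη2⟩ := H (-R x - c') (by linarith)
        refine hc1.trans_le (le_liminf_of_le (by isBoundedDefault) ?_)
        filter_upwards [hη2, eventually_ge_atTop 1] with n hn hn1
        refine le_trans ?_ (le_div_mul_log hn1 hn)
        exact_mod_cast (by linarith : c' ≤ -(R x + η))
      intro η₀ hη₀
      obtain ⟨δ, hδ, hball⟩ := Metric.isOpen_iff.1 isOpen_interior x hx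
      have hΓ' : ∀ y, |y - x| < δ → y ∈ Γ := fun y hy =>
        interior_subset (hball (by rwa [Metric.mem_ball, Real.dist_eq]))
      rcases le_total 0 x with h0 | h0
      -- The event contains {x ≤ Y < b}, and removing {b ≤ Y} costs little because its rate is
      -- strictly larger.
      · set b := x + δ / 2 with hb
        have hRb : R x < R b := sub_log_lt_sub_log hx1 (by linarith) (by linarith)
          (mul_nonneg (by linarith) h0)
        set ε := min (η₀ / 2) ((R b - R x) / 4) with hεd
        have hε : 0 < ε := lt_min (by linarith) (by linarith)
        have hε1 : ε ≤ η₀ / 2 := min_le_left _ _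
        have hε2 : ε ≤ (R b - R x) / 4 := min_le_right _ _
        refine ⟨ε + ε, by linarith, by linarith, ?_⟩
        filter_upwards [le_upper x h0 ε hε, upper_le b (by linarith) ε hε,
          eventually_exp_sub_exp hε (by linarith : (R x + ε) + 2 * ε ≤ R b - ε)] with n h1 h2 h3
        have h4 : P.real {ω | x ≤ Y n ω} ≤
            P.real {ω | Y n ω ∈ Γ} + P.real {ω | b ≤ Y n ω} := by
          refine (measureReal_mono ?_).trans (measureReal_union_le _ _)
          intro ω (hω : x ≤ Y n ω)
          by_cases hb' : b ≤ Y n ω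
          · exact Or.inr hb'
          · refine Or.inl (hΓ' _ ?_)
            rw [abs_of_nonneg (by linarith)]
            linarith [not_le.1 hb']
        simp only [hR] at h3 ⊢
        rw [← add_assoc]
        linarith
      -- The mirror image; the midpoint of -1 and x keeps b inside the domain of finite rate.
      · set b := max (x - δ / 2) ((x - 1) / 2) with hb
        have hb1 : -1 < b := lt_of_lt_of_le (by linarith) (le_max_right _ _)
        have hb2 : b < x := max_lt (by linarith) (by linarith)
        have hb3 : x - δ / 2 ≤ b := le_max_left _ _
        have hRb : R x < R b := sub_log_lt_sub_log hx1 hb1 hb2.ne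
          (mul_nonneg_of_nonpos_of_nonpos (by linarith) h0)
        set ε := min (η₀ / 2) ((R b - R x) / 4) with hεd
        have hε : 0 < ε := lt_min (by linarith) (by linarith)
        have hε1 : ε ≤ η₀ / 2 := min_le_left _ _
        have hε2 : ε ≤ (R b - R x) / 4 := min_le_right _ _
        refine ⟨ε + ε, by linarith, by linarith, ?_⟩
        filter_upwards [le_lower x hx1 h0 ε hε, lower_le b hb1 (by linarith) ε hε,
          eventually_exp_sub_exp hε (by linarith : (R x + ε) + 2 * ε ≤ R b - ε)] with n h1 h2 h3
        have h4 : P.real {ω | Y n ω < x} ≤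
            P.real {ω | Y n ω ∈ Γ} + P.real {ω | Y n ω < b} := by
          refine (measureReal_mono ?_).trans (measureReal_union_le _ _)
          intro ω (hω : Y n ω < x)
          by_cases hb' : Y n ω < b
          · exact Or.inr hb'
          · refine Or.inl (hΓ' _ ?_)
            rw [abs_of_neg (by linarith)]
            linarith [not_lt.1 hb']
        simp only [hR] at h3 ⊢
        rw [← add_assoc]
        linarith
    · rw [EReal.le_neg]
      apply le_of_forall_lt
      intro c hc
      obtain ⟨c', hc1, hc2⟩ := EReal.lt_iff_exists_real_btwn.1 hc
      refine hc1.trans_le ?_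
      rw [EReal.le_neg]
      rcases le_or_gt c' 0 with hc0 | hc0
      · refine (limsup_le_of_le (by isBoundedDefault)
          (Eventually.of_forall fun n => div_mul_log_nonpos _ n)).trans ?_
        rw [← EReal.coe_neg]
        exact_mod_cast neg_nonneg.2 hc0
      -- The rate is at most c' on [u, v], so Γ avoids [u, v) and is covered by two tails of rate
      -- c'.
      obtain ⟨⟨v, hv0, hv⟩, u, hu1, hu0, hu⟩ := exists_sub_log_eq hc0
      have hsub : ∀ x ∈ Γ, v ≤ x ∨ x < u := by
        intro x hx
        by_contra! hcon
        have hx1 : -1 < x := by linarith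
        have h1 : ((c' : ℝ) : EReal) < ((rateC x : ℝ≥0∞) : EReal) :=
          hc2.trans_le (iInf₂_le x (subset_closure hx))
        rw [coe_rateC_of_lt hx1] at h1
        have h2 : c' < x - Real.log (x + 1) := by exact_mod_cast h1
        rcases le_total 0 x with h0 | h0
        · have := sub_log_le_sub_log hx1 (by linarith : -1 < v)
            (mul_nonneg (by linarith) h0)
          linarith
        · have := sub_log_le_sub_log hx1 hu1
            (mul_nonneg_of_nonpos_of_nonpos (by linarith) h0)
          linarith
      apply le_of_forall_gt
      intro e he
      obtain ⟨e', he1, he2⟩ := EReal.lt_iff_exists_real_btwn.1 he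
      have he3 : -c' < e' := by
        rw [← EReal.coe_neg] at he1
        exact_mod_cast he1
      refine lt_of_le_of_lt (limsup_le_of_le (by isBoundedDefault) ?_) he2
      set ε := (e' + c') / 2 with hεd
      have hε : 0 < ε := by linarith
      have h2 : ∀ᶠ n : ℕ in atTop, Real.log 2 ≤ n * ε :=
        (tendsto_natCast_atTop_atTop.atTop_mul_const hε).eventually_ge_atTop _
      filter_upwards [upper_le v hv0 ε hε, lower_le u hu1 hu0 ε hε, h2, eventually_ge_atTop 1]
        with n h3 h4 h5 hn1
      rw [hv] at h3
      rw [hu] at h4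
      have h6 : P.real {ω | Y n ω ∈ Γ} ≤ P.real {ω | v ≤ Y n ω} + P.real {ω | Y n ω < u} :=
        by
        refine (measureReal_mono ?_).trans (measureReal_union_le _ _)
        exact fun ω hω => hsub _ hω
      -- The factor 2 counts the two tails and is absorbed by exp(nε).
      have h7 : 2 * Real.exp (-(n * (c' - ε))) ≤ Real.exp (-(n * (-e'))) := by
        have h8 : -(n * (-e')) = n * ε + -(n * (c' - ε)) := by rw [hεd]; ring
        rw [h8, Real.exp_add]
        gcongr
        rwa [← Real.log_le_iff_le_exp (by norm_num)]
      have := div_mul_log_le (P := P) (A := {ω | Y n ω ∈ Γ}) hn1 (c := -e') (by linarith)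
      simpa using this

lemma tendsto_log_ceil_sub_one {b : ℝ} (hb : 0 < b) :
    Tendsto (fun n : ℕ => Real.log ((⌈Real.exp (n * b)⌉₊ - 1 : ℕ) : ℝ) / (n : ℝ)) atTop (nhds b) := by
  have h0 : ∀ᶠ n : ℕ in atTop, Real.log 2 ≤ n * b :=
    (tendsto_natCast_atTop_atTop.atTop_mul_const hb).eventually_ge_atTop _
  have h1 : Tendsto (fun n : ℕ => b - Real.log 2 / (n : ℝ)) atTop (nhds b) := by
    simpa using (tendsto_const_nhds (x := b)).sub
      ((tendsto_const_nhds (x := Real.log 2)).div_atTop tendsto_natCast_atTop_atTop)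
  refine tendsto_of_tendsto_of_tendsto_of_le_of_le' h1 tendsto_const_nhds ?_ ?_
  all_goals
    filter_upwards [h0, eventually_ge_atTop 1] with n hn hn1
    have hn0 : (0 : ℝ) < n := by exact_mod_cast hn1
    have he : 2 ≤ Real.exp (n * b) := by rwa [← Real.log_le_iff_le_exp (by norm_num)]
    have hc : 1 ≤ ⌈Real.exp (n * b)⌉₊ := Nat.one_le_ceil_iff.2 (Real.exp_pos _)
    have hl := Nat.le_ceil (Real.exp (n * b))
    have hu := Nat.ceil_lt_add_one (Real.exp_pos (n * b)).le
    rw [Nat.cast_sub hc, Nat.cast_one]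
  · rw [le_div_iff₀ hn0]
    have e : (b - Real.log 2 / (n : ℝ)) * n = n * b - Real.log 2 := by field_simp
    rw [e, Real.le_log_iff_exp_le (by linarith), Real.exp_sub, Real.exp_log (by norm_num)]
    linarith
  · rw [div_le_iff₀ hn0, Real.log_le_iff_le_exp (by linarith), mul_comm b]
    linarith

/-- If `P (D n ≤ m)` satisfies the recurrence of the record times, then `(log (D n) - n) / n`
satisfies the large deviation principle with rate function `rateC`. -/
theorem satisfiesLDP_of_isRecordArray {D : ℕ → Ω → ℕ} (hD : ∀ n, AEMeasurable (D n) P)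
    (hpos : ∀ n, ∀ᵐ ω ∂P, 1 ≤ D n ω)
    {p : ℕ → ℕ → ℝ} (hp : IsRecordArray p)
    (hDp : ∀ n m, 1 ≤ m → P.real {ω | D n ω ≤ m} = p n m) :
    SatisfiesLDP P (fun (n : ℕ) (ω : Ω) => (Real.log (D n ω : ℝ) - n) / n) rateC := by
  -- The largest integer strictly below exp(nb): the strict event log D < nb becomes D ≤ M.
  set M : ℝ → ℕ → ℕ := fun b n => ⌈Real.exp (n * b)⌉₊ - 1 with hM
  have hM1 : ∀ b, 0 < b → ∀ᶠ n : ℕ in atTop, 1 ≤ M b n := by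
    intro b hb
    have h0 : ∀ᶠ n : ℕ in atTop, Real.log 2 ≤ n * b :=
      (tendsto_natCast_atTop_atTop.atTop_mul_const hb).eventually_ge_atTop _
    filter_upwards [h0] with n hn
    have he : 2 ≤ Real.exp (n * b) := by rwa [← Real.log_le_iff_le_exp (by norm_num)]
    have h2 : (2 : ℝ) ≤ (⌈Real.exp (n * b)⌉₊ : ℝ) := he.trans (Nat.le_ceil _)
    have h3 : 2 ≤ ⌈Real.exp (n * b)⌉₊ := by exact_mod_cast h2
    simp only [hM]
    omega
  have key : ∀ b, 0 < b → ∀ᶠ n : ℕ in atTop, ∀ᵐ ω ∂P,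
      ((Real.log (D n ω : ℝ) - n) / n < b - 1 ↔ D n ω ≤ M b n) := by
    intro b hb
    filter_upwards [eventually_ge_atTop 1] with n hn1
    filter_upwards [hpos n] with ω hω
    have hn0 : (0 : ℝ) < n := by exact_mod_cast hn1
    have hω0 : (0 : ℝ) < D n ω := by exact_mod_cast hω
    have hc : 1 ≤ ⌈Real.exp (n * b)⌉₊ := Nat.one_le_ceil_iff.2 (Real.exp_pos _)
    have e : D n ω ≤ M b n ↔ D n ω < ⌈Real.exp (n * b)⌉₊ := by simp only [hM]; omega
    rw [e, Nat.lt_ceil, ← Real.log_lt_iff_lt_exp hω0, div_lt_iff₀ hn0]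
    constructor <;> intro h <;> linarith
  have hlow : ∀ b, 0 < b → ∀ᶠ n : ℕ in atTop,
      P.real {ω | (Real.log (D n ω : ℝ) - n) / n < b - 1} = p n (M b n) := by
    intro b hb
    filter_upwards [key b hb, hM1 b hb] with n h1 h2
    rw [← hDp n _ h2]
    exact measureReal_congr (h1.mono fun ω hω => propext hω)
  have hupp : ∀ b, 0 < b → ∀ᶠ n : ℕ in atTop,
      P.real {ω | b - 1 ≤ (Real.log (D n ω : ℝ) - n) / n} = 1 - p n (M b n) := by
    intro b hb
    filter_upwards [key b hb, hM1 b hb] with n h1 h2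
    have h3 : NullMeasurableSet {ω | D n ω ≤ M b n} P :=
      (hD n).nullMeasurable (measurableSet_Iic (a := M b n))
    rw [← hDp n _ h2, ← probReal_compl_eq_one_sub₀ h3]
    refine measureReal_congr (h1.mono fun ω hω => propext ?_)
    exact not_lt.symm.trans (not_congr hω)
  refine satisfiesLDP_of_tails (fun n => ?_) ?_ ?_ ?_ ?_
  · have h1 : AEMeasurable (fun ω => (D n ω : ℝ)) P := measurable_from_nat.comp_aemeasurable (hD n)
    exact ((Real.measurable_log.comp_aemeasurable h1).sub_const _).div_const _
  · intro a ha ε hε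
    filter_upwards [hupp (a + 1) (by linarith), hp.eventually_compl_le (b := a + 1) (by linarith) hε
      (hM1 (a + 1) (by linarith)) (tendsto_log_ceil_sub_one (by linarith))] with n h1 h2
    rw [add_sub_cancel_right] at h1 h2
    exact h1.trans_le h2
  · intro a ha ha0 ε hε
    filter_upwards [hlow (a + 1) (by linarith), hp.eventually_le (b := a + 1) (by linarith)
      (by linarith) hε (hM1 (a + 1) (by linarith)) (tendsto_log_ceil_sub_one (by linarith))]
      with n h1 h2
    rw [add_sub_cancel_right] at h1 h2
    exact h1.trans_le h2
  · intro a ha ε hε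
    filter_upwards [hupp (a + 1) (by linarith), hp.eventually_compl_ge (b := a + 1) (by linarith) hε
      (tendsto_log_ceil_sub_one (by linarith))] with n h1 h2
    rw [add_sub_cancel_right] at h1 h2
    exact h2.trans_eq h1.symm
  · intro a ha ha0 ε hε
    filter_upwards [hlow (a + 1) (by linarith), hp.eventually_ge (b := a + 1) (by linarith) hε
      (tendsto_log_ceil_sub_one (by linarith))] with n h1 h2
    rw [add_sub_cancel_right] at h1 h2
    exact h2.trans_eq h1.symm

end LDP

/-! ### Modified Engel series -/

/-- The first digit of the modified Engel series. -/
noncomputable def engelDigit (x : ℝ) : ℕ := ⌊1 / x⌋₊ + 1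

/-- The shift of the modified Engel series. -/
noncomputable def engelMap (x : ℝ) : ℝ := ((engelDigit x : ℝ) - 1) * (x - 1 / engelDigit x)

/-- The digits of the modified Engel series. -/
noncomputable def engelSeq (x : ℝ) : ℕ → ℕ
  | 0 => 1
  | n + 1 => engelDigit (engelMap^[n] x)

lemma engelDigit_eq_iff {x : ℝ} (hx : 0 < x) {k : ℕ} (hk : 2 ≤ k) :
    engelDigit x = k ↔ x ∈ Set.Ioc (1 / (k : ℝ)) (1 / ((k : ℝ) - 1)) := by
  obtain ⟨k, rfl⟩ : ∃ l, k = l + 1 := ⟨k - 1, by omega⟩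
  have hk0 : (0 : ℝ) < k := by exact_mod_cast (by omega : 0 < k)
  rw [engelDigit, add_left_inj, Nat.floor_eq_iff (by positivity)]
  push_cast
  rw [add_sub_cancel_right, Set.mem_Ioc, div_lt_iff₀ hx, div_lt_iff₀ (by positivity),
    le_div_iff₀ hx, le_div_iff₀ hk0, mul_comm x, mul_comm x, and_comm]

/-- The digit k occupies the interval (1/k, 1/(k-1)]. Closing it on the right makes (0, 1] invariant
under `engelMap`, which may take the value 1/k. -/
lemma engelDigit_le_iff {x : ℝ} (hx : 0 < x) {m : ℕ} (hm : 1 ≤ m) :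
    engelDigit x ≤ m ↔ 1 / (m : ℝ) < x := by
  have hm0 : (0 : ℝ) < m := by exact_mod_cast hm
  rw [engelDigit, Nat.add_one_le_iff, Nat.floor_lt (by positivity), div_lt_iff₀ hx,
    div_lt_iff₀ hm0, mul_comm]

lemma lt_engelDigit {x : ℝ} (hx : 0 < x) {j : ℕ} (hj : 1 ≤ j) (hxj : x ≤ 1 / (j : ℝ)) :
    j < engelDigit x := by
  by_contra hcon
  exact absurd ((engelDigit_le_iff hx hj).1 (not_lt.1 hcon)) (not_lt.2 hxj)

lemma two_le_engelDigit {x : ℝ} (hx : x ∈ Set.Ioc (0 : ℝ) 1) : 2 ≤ engelDigit x :=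
  lt_engelDigit hx.1 le_rfl (by simpa using hx.2)

lemma affine_mem_Ioc_iff {k : ℕ} (hk : 2 ≤ k) (x : ℝ) :
    ((k : ℝ) - 1) * (x - 1 / k) ∈ Set.Ioc (0 : ℝ) (1 / k) ↔
      x ∈ Set.Ioc (1 / (k : ℝ)) (1 / ((k : ℝ) - 1)) := by
  have hk2 : (2 : ℝ) ≤ k := by exact_mod_cast hk
  have hk1 : 0 < (k : ℝ) - 1 := by linarith
  have hk0 : (0 : ℝ) < k := by linarith
  have e : 1 / (k : ℝ) = ((k : ℝ) - 1) * (1 / ((k : ℝ) - 1) - 1 / k) := by field_simp; ring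
  have h1 : ((k : ℝ) - 1) * (x - 1 / k) ≤ 1 / k ↔ x ≤ 1 / ((k : ℝ) - 1) := by
    rw [show (((k : ℝ) - 1) * (x - 1 / k) ≤ 1 / k) ↔ (((k : ℝ) - 1) * (x - 1 / k) ≤
      ((k : ℝ) - 1) * (1 / ((k : ℝ) - 1) - 1 / k)) by rw [← e], mul_le_mul_iff_right₀ hk1]
    constructor <;> intro h <;> linarith
  rw [Set.mem_Ioc, Set.mem_Ioc, h1, mul_pos_iff_of_pos_left hk1, sub_pos]

lemma engelMap_mem {x : ℝ} (hx : x ∈ Set.Ioc (0 : ℝ) 1) :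
    engelMap x ∈ Set.Ioc (0 : ℝ) (1 / engelDigit x) := by
  have h2 := two_le_engelDigit hx
  exact (affine_mem_Ioc_iff h2 x).2 ((engelDigit_eq_iff hx.1 h2).1 rfl)

lemma engelMap_mem_Ioc {x : ℝ} (hx : x ∈ Set.Ioc (0 : ℝ) 1) :
    engelMap x ∈ Set.Ioc (0 : ℝ) 1 := by
  have h2 : (2 : ℝ) ≤ engelDigit x := by exact_mod_cast two_le_engelDigit hx
  have h := engelMap_mem hx
  refine ⟨h.1, h.2.trans ?_⟩
  rw [div_le_one (by linarith)]
  linarith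

lemma engelMap_iterate_mem {x : ℝ} (hx : x ∈ Set.Ioc (0 : ℝ) 1) (n : ℕ) :
    engelMap^[n] x ∈ Set.Ioc (0 : ℝ) 1 := by
  induction n with
  | zero => simpa using hx
  | succ n ih => rw [Function.iterate_succ_apply']; exact engelMap_mem_Ioc ih

lemma engelSeq_lt_succ {x : ℝ} (hx : x ∈ Set.Ioc (0 : ℝ) 1) (n : ℕ) :
    engelSeq x n < engelSeq x (n + 1) := by
  cases n with
  | zero => exact two_le_engelDigit hx
  | succ n =>
    have h := engelMap_iterate_mem hx n
    have h1 := engelMap_mem h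
    have h2 := two_le_engelDigit h
    simp only [engelSeq, Function.iterate_succ_apply']
    exact lt_engelDigit h1.1 (by omega) h1.2

lemma engelSeq_strictMono {x : ℝ} (hx : x ∈ Set.Ioc (0 : ℝ) 1) : StrictMono (engelSeq x) :=
  strictMono_nat_of_lt_succ (engelSeq_lt_succ hx)

lemma engelSeq_add_two (x : ℝ) (n : ℕ) : engelSeq x (n + 2) = engelSeq (engelMap x) (n + 1) := by
  simp [engelSeq]

lemma prod_Icc_one {M : Type*} [CommMonoid M] (f : ℕ → M) (n : ℕ) :
    ∏ i ∈ Finset.Icc 1 n, f i = ∏ i ∈ Finset.range n, f (i + 1) := by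
  induction n with
  | zero => simp
  | succ n ih => rw [Finset.prod_Icc_succ_top (by omega), ih, Finset.prod_range_succ]

lemma isModifiedEngelSeries_engelSeq {x : ℝ} (hx : x ∈ Set.Ioc (0 : ℝ) 1) :
    IsModifiedEngelSeries (engelSeq x) x where
  zero := rfl
  two_le := two_le_engelDigit hx
  succ_le n _ := engelSeq_lt_succ hx n
  hasSum := by
    simp only [prod_Icc_one]
    have hd (i : ℕ) : (2 : ℝ) ≤ engelSeq x (i + 1) := by
      have : 2 ≤ engelSeq x (i + 1) := two_le_engelDigit (engelMap_iterate_mem hx i)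
      exact_mod_cast this
    have hprod (n : ℕ) : 1 ≤ ∏ i ∈ Finset.range n, ((engelSeq x (i + 1) : ℝ) - 1) :=
      (Finset.prod_const_one (s := Finset.range n)).symm.le.trans
        (Finset.prod_le_prod (fun _ _ => zero_le_one) fun i _ => by linarith [hd i])
    rw [hasSum_iff_tendsto_nat_of_nonneg (fun n => by
      have := hprod n; have := hd n; positivity)]
    -- Unfolding x = 1/d₁ + T(x)/(d₁ - 1) exactly N times leaves this remainder, which is at most
    -- 1/N because the digits increase strictly.
    have hsum (N : ℕ) : ∑ n ∈ Finset.range N,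
        1 / ((∏ i ∈ Finset.range n, ((engelSeq x (i + 1) : ℝ) - 1)) * (engelSeq x (n + 1) : ℝ)) =
        x - engelMap^[N] x / ∏ i ∈ Finset.range N, ((engelSeq x (i + 1) : ℝ) - 1) := by
      induction N with
      | zero => simp
      | succ N ih =>
        rw [Finset.sum_range_succ, ih, Function.iterate_succ_apply', Finset.prod_range_succ]
        have h1 := hprod N
        have h2 := hd N
        have h3 : (engelSeq x (N + 1) : ℝ) - 1 ≠ 0 := by linarith
        have h4 : (engelSeq x (N + 1) : ℝ) ≠ 0 := by linarith
        have e : engelMap (engelMap^[N] x) = ((engelSeq x (N + 1) : ℝ) - 1) *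
          (engelMap^[N] x - 1 / engelSeq x (N + 1)) := rfl
        rw [e]
        field_simp
        ring
    simp only [hsum]
    have h0 : Tendsto (fun N : ℕ => engelMap^[N] x /
        ∏ i ∈ Finset.range N, ((engelSeq x (i + 1) : ℝ) - 1)) atTop (nhds 0) := by
      rw [← tendsto_add_atTop_iff_nat 1]
      refine squeeze_zero (fun N => ?_) (fun N => ?_) tendsto_one_div_add_atTop_nhds_zero_nat
      · exact div_nonneg (engelMap_iterate_mem hx _).1.le (by linarith [hprod (N + 1)])
      · refine (div_le_self (engelMap_iterate_mem hx _).1.le (hprod (N + 1))).trans ?_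
        rw [Function.iterate_succ_apply']
        refine (engelMap_mem (engelMap_iterate_mem hx N)).2.trans ?_
        have h5 : N + 1 ≤ engelDigit (engelMap^[N] x) := (engelSeq_strictMono hx).le_apply (x := N + 1)
        have h6 : (N : ℝ) + 1 ≤ engelDigit (engelMap^[N] x) := by exact_mod_cast h5
        exact one_div_le_one_div_of_le (by positivity) h6
    simpa using h0.const_sub x

/-! ### Uniqueness of the digits -/

namespace IsModifiedEngelSeries

variable {d : ℕ → ℕ} {x : ℝ}

lemma two_le_succ (h : IsModifiedEngelSeries d x) (n : ℕ) : 2 ≤ d (n + 1) := by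
  induction n with
  | zero => exact h.two_le
  | succ n ih => have := h.succ_le (n + 1) (by omega); omega

lemma prod_pos (h : IsModifiedEngelSeries d x) (n : ℕ) :
    0 < ∏ i ∈ Finset.range n, ((d (i + 1) : ℝ) - 1) :=
  Finset.prod_pos fun i _ => by
    have : (2 : ℝ) ≤ d (i + 1) := by exact_mod_cast h.two_le_succ i
    linarith

lemma hasSum_range (h : IsModifiedEngelSeries d x) : HasSum (fun n : ℕ =>
    1 / ((∏ i ∈ Finset.range n, ((d (i + 1) : ℝ) - 1)) * (d (n + 1) : ℝ))) x := by
  simpa only [prod_Icc_one] using h.hasSum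

/-- This locates x in the interval of its first digit, which forces that digit. The upper bound
telescopes: for digits u, v with v ≥ u + 1, the term 1/(Qu) is at most 1/(Q(u-1)) - 1/(Q(u-1)(v-1)).
-/
lemma mem_Ioc (h : IsModifiedEngelSeries d x) :
    x ∈ Set.Ioc (1 / (d 1 : ℝ)) (1 / ((d 1 : ℝ) - 1)) := by
  have hs := h.hasSum_range
  have hpos (n : ℕ) :
      0 < 1 / ((∏ i ∈ Finset.range n, ((d (i + 1) : ℝ) - 1)) * (d (n + 1) : ℝ)) := by
    have h1 := h.prod_pos n
    have h2 : (0 : ℝ) < d (n + 1) := by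
      have := h.two_le_succ n
      exact_mod_cast (by omega : 0 < d (n + 1))
    positivity
  constructor
  · have h1 := sum_le_hasSum (Finset.range 2) (fun n _ => (hpos n).le) hs
    rw [Finset.sum_range_succ, Finset.sum_range_one] at h1
    have := hpos 1
    simp only [Finset.range_zero, Finset.prod_empty, one_mul, zero_add] at h1
    linarith
  · refine le_of_tendsto' hs.tendsto_sum_nat fun N => ?_
    set a : ℕ → ℝ := fun n => 1 / ∏ i ∈ Finset.range (n + 1), ((d (i + 1) : ℝ) - 1) with ha
    have hle (n : ℕ) : 1 / ((∏ i ∈ Finset.range n, ((d (i + 1) : ℝ) - 1)) * (d (n + 1) : ℝ)) ≤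
        a n - a (n + 1) := by
      simp only [ha]
      rw [Finset.prod_range_succ _ (n + 1), Finset.prod_range_succ _ n]
      have h1 := h.prod_pos n
      set Q := ∏ i ∈ Finset.range n, ((d (i + 1) : ℝ) - 1)
      have h2 : (2 : ℝ) ≤ d (n + 1) := by exact_mod_cast h.two_le_succ n
      have h3 : (d (n + 1) : ℝ) + 1 ≤ d (n + 1 + 1) := by
        exact_mod_cast h.succ_le (n + 1) (by omega)
      set u : ℝ := (d (n + 1) : ℝ)
      set v : ℝ := (d (n + 1 + 1) : ℝ)
      have hu : 0 < u - 1 := by linarith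
      have hv : 0 < v - 1 := by linarith
      have e : 1 / (Q * (u - 1)) - 1 / (Q * (u - 1) * (v - 1)) - 1 / (Q * u) =
          (v - 1 - u) / (Q * u * (u - 1) * (v - 1)) := by
        field_simp; ring
      have : 0 ≤ (v - 1 - u) / (Q * u * (u - 1) * (v - 1)) :=
        div_nonneg (by linarith) (by positivity)
      linarith
    refine (Finset.sum_le_sum fun n _ => hle n).trans ?_
    rw [Finset.sum_range_sub']
    have h4 : 0 < a N := one_div_pos.2 (h.prod_pos _)
    have h5 : a 0 = 1 / ((d 1 : ℝ) - 1) := by simp [ha]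
    linarith

lemma digit_eq (h : IsModifiedEngelSeries d x) : engelDigit x = d 1 := by
  have h1 := h.mem_Ioc
  have h2 : (2 : ℝ) ≤ d 1 := by exact_mod_cast h.two_le
  exact (engelDigit_eq_iff (lt_trans (by positivity) h1.1) h.two_le).2 h1

lemma shift (h : IsModifiedEngelSeries d x) :
    IsModifiedEngelSeries (fun n => if n = 0 then 1 else d (n + 1)) (engelMap x) where
  zero := by simp
  two_le := by simpa using h.two_le_succ 1
  succ_le n hn := by
    have : n ≠ 0 := by omega
    simpa [this] using h.succ_le (n + 1) (by omega)
  hasSum := by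
    have hs := h.hasSum_range
    rw [← hasSum_nat_add_iff' 1] at hs
    have h2 : (2 : ℝ) ≤ d 1 := by exact_mod_cast h.two_le
    have hs2 := hs.mul_left ((d 1 : ℝ) - 1)
    have e : ((d 1 : ℝ) - 1) * (x - ∑ i ∈ Finset.range 1,
        1 / ((∏ j ∈ Finset.range i, ((d (j + 1) : ℝ) - 1)) * (d (i + 1) : ℝ))) = engelMap x := by
      simp [engelMap, h.digit_eq]
    rw [e] at hs2
    refine hs2.congr_fun ?_
    intro n
    rw [prod_Icc_one, Finset.prod_range_succ']
    have h3 : (d 1 : ℝ) - 1 ≠ 0 := by linarith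
    simp only [Nat.add_eq_zero_iff, one_ne_zero, and_false, if_false, zero_add]
    field_simp

lemma eq_engelSeq (h : IsModifiedEngelSeries d x) : d = engelSeq x := by
  have key (n : ℕ) : ∀ (d : ℕ → ℕ) (x : ℝ), IsModifiedEngelSeries d x →
      d (n + 1) = engelSeq x (n + 1) := by
    induction n with
    | zero => exact fun d x h => h.digit_eq.symm
    | succ n ih =>
      intro d x h
      have := ih _ _ h.shift
      rw [engelSeq_add_two, ← this]
      simp
  funext n
  cases n with
  | zero => exact h.zero
  | succ n => exact key n d x h

end IsModifiedEngelSeries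

/-! ### The distribution of the digits -/

lemma measurable_engelDigit : Measurable engelDigit :=
  (Nat.measurable_floor.comp (measurable_const.div measurable_id)).add_const 1

lemma measurable_engelMap : Measurable engelMap := by
  have h : Measurable fun x => (engelDigit x : ℝ) :=
    measurable_from_nat.comp measurable_engelDigit
  exact (h.sub_const 1).mul (measurable_id.sub (measurable_const.div h))

lemma measurable_engelSeq (n : ℕ) : Measurable fun x => engelSeq x n := by
  cases n with
  | zero => exact measurable_const
  | succ n => exact measurable_engelDigit.comp (measurable_engelMap.iterate n)

/-- The Lebesgue measure of `{x ∈ (0, 1 / j] | engelSeq x n ≤ m}`, for `1 ≤ j ≤ m`. -/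
noncomputable def engelVolume : ℕ → ℕ → ℕ → ℝ
  | 0, j, _ => 1 / j
  | n + 1, j, m => ∑ k ∈ Finset.Ioc j m, engelVolume n k m / ((k : ℝ) - 1)

/-- The set whose Lebesgue measure is `engelVolume`. -/
def engelSet (n j m : ℕ) : Set ℝ := {x | x ∈ Set.Ioc (0 : ℝ) (1 / j) ∧ engelSeq x n ≤ m}

lemma measurableSet_engelSet (n j m : ℕ) : MeasurableSet (engelSet n j m) :=
  measurableSet_Ioc.inter (measurable_engelSeq n measurableSet_Iic)

/-- Partition by the first digit k. It exceeds j because x ≤ 1/j, and the affine branch maps its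
interval onto (0, 1/k], which is again of the same form; hence the parameter j. -/
lemma engelSet_succ {n j m : ℕ} (hj : 1 ≤ j) (hm : j ≤ m) :
    engelSet (n + 1) j m = ⋃ k ∈ Finset.Ioc j m,
      (fun x : ℝ => ((k : ℝ) - 1) * (x - 1 / k)) ⁻¹' engelSet n k m := by
  have hj0 : (1 : ℝ) ≤ j := by exact_mod_cast hj
  have hshift {x : ℝ} (hx : x ∈ Set.Ioc (0 : ℝ) 1) :
      engelSeq x (n + 1) ≤ m ↔ engelDigit x ≤ m ∧ engelSeq (engelMap x) n ≤ m := by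
    cases n with
    | zero => simp [engelSeq]; omega
    | succ n =>
      rw [← engelSeq_add_two]
      exact ⟨fun h => ⟨((engelSeq_strictMono hx).monotone (by omega : 1 ≤ n + 2)).trans h, h⟩,
        fun h => h.2⟩
  ext x
  simp only [Set.mem_iUnion, Set.mem_preimage, Finset.mem_Ioc, exists_prop, engelSet,
    Set.mem_ofPred_eq]
  constructor
  · rintro ⟨hx, hxm⟩
    have hx1 : x ∈ Set.Ioc (0 : ℝ) 1 := ⟨hx.1, hx.2.trans ((div_le_one (by linarith)).2 hj0)⟩
    have h := (hshift hx1).1 hxm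
    exact ⟨engelDigit x, ⟨lt_engelDigit hx.1 hj hx.2, h.1⟩, engelMap_mem hx1, h.2⟩
  · rintro ⟨k, ⟨hjk, hkm⟩, h1, h2⟩
    have hk2 : 2 ≤ k := by omega
    have h3 := (affine_mem_Ioc_iff hk2 x).1 h1
    have hx0 : 0 < x := lt_trans (by positivity) h3.1
    have hjk' : (j : ℝ) ≤ (k : ℝ) - 1 := by
      have : (j : ℝ) + 1 ≤ k := by exact_mod_cast hjk
      linarith
    have hxj : x ≤ 1 / j := h3.2.trans (one_div_le_one_div_of_le (by linarith) hjk')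
    have hx1 : x ∈ Set.Ioc (0 : ℝ) 1 := ⟨hx0, hxj.trans ((div_le_one (by linarith)).2 hj0)⟩
    have hdig := (engelDigit_eq_iff hx0 hk2).2 h3
    refine ⟨⟨hx0, hxj⟩, (hshift hx1).2 ⟨by omega, ?_⟩⟩
    rwa [engelMap, hdig]

lemma volume_real_preimage_affine {a : ℝ} (ha : 0 < a) (c : ℝ) (s : Set ℝ) :
    volume.real ((fun x : ℝ => a * (x - c)) ⁻¹' s) = volume.real s / a := by
  have e : (fun x : ℝ => a * (x - c)) ⁻¹' s = (fun x => x + -c) ⁻¹' ((a * ·) ⁻¹' s) := by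
    ext x; simp [sub_eq_add_neg]
  rw [e, measureReal_def, measure_preimage_add_right, Real.volume_preimage_mul_left ha.ne',
    ENNReal.toReal_mul, ENNReal.toReal_ofReal (abs_nonneg _), abs_of_pos (inv_pos.2 ha),
    measureReal_def, div_eq_inv_mul]

lemma volume_engelSet (n : ℕ) {j m : ℕ} (hj : 1 ≤ j) (hm : j ≤ m) :
    volume.real (engelSet n j m) = engelVolume n j m := by
  induction n generalizing j with
  | zero =>
    have : engelSet 0 j m = Set.Ioc (0 : ℝ) (1 / j) := by
      ext x; simp [engelSet, engelSeq]; omega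
    rw [this, Real.volume_real_Ioc_of_le (by positivity), sub_zero, engelVolume]
  | succ n ih =>
    rw [engelSet_succ hj hm, engelVolume, measureReal_biUnion_finset ?_ ?_ ?_]
    · refine Finset.sum_congr rfl fun k hk => ?_
      rw [Finset.mem_Ioc] at hk
      have hk2 : (2 : ℝ) ≤ k := by exact_mod_cast (by omega : 2 ≤ k)
      rw [volume_real_preimage_affine (by linarith), ih (by omega) hk.2]
    · intro k hk l hl hkl
      simp only [Finset.coe_Ioc, Set.mem_Ioc] at hk hl
      refine Set.disjoint_left.2 fun x hxk hxl => hkl ?_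
      have h1 := (affine_mem_Ioc_iff (by omega : 2 ≤ k) x).1 hxk.1
      have h2 := (affine_mem_Ioc_iff (by omega : 2 ≤ l) x).1 hxl.1
      have hx0 : 0 < x := lt_trans (by
        have : (0 : ℝ) < k := by exact_mod_cast (by omega : 0 < k)
        positivity) h1.1
      rw [← (engelDigit_eq_iff hx0 (by omega)).2 h1, (engelDigit_eq_iff hx0 (by omega)).2 h2]
    · intro k _
      exact (measurable_const.mul (measurable_id.sub_const _)) (measurableSet_engelSet n k m)
    · intro k hk
      rw [Finset.mem_Ioc] at hk
      have hsub : (fun x : ℝ => ((k : ℝ) - 1) * (x - 1 / k)) ⁻¹' engelSet n k m ⊆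
          Set.Ioc (1 / (k : ℝ)) (1 / ((k : ℝ) - 1)) :=
        fun x hx => (affine_mem_Ioc_iff (by omega : 2 ≤ k) x).1 hx.1
      exact measure_ne_top_of_subset hsub measure_Ioc_lt_top.ne

lemma engelVolume_one {j m : ℕ} (hj : 1 ≤ j) (hm : j ≤ m) :
    engelVolume 1 j m = 1 / j - 1 / m := by
  induction m, hm using Nat.le_induction with
  | base => simp [engelVolume]
  | succ m hm ih =>
    have hm0 : (0 : ℝ) < m := by exact_mod_cast (by omega : 0 < m)
    rw [engelVolume, Finset.sum_Ioc_succ_top (by omega)]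
    simp only [engelVolume] at ih ⊢
    rw [ih]
    push_cast
    rw [add_sub_cancel_right]
    field_simp
    ring

/-- The recurrence passes through the sum over the first digit. The only extra term, k = m + 1,
vanishes because no later digit can be at most m + 1. -/
lemma engelVolume_recurrence (n : ℕ) {j m : ℕ} (hj : 1 ≤ j) (hm : j ≤ m) :
    ((m : ℝ) + 1) * engelVolume (n + 1) j (m + 1) =
      m * engelVolume (n + 1) j m + engelVolume n j m := by
  induction n generalizing j with
  | zero =>
    have hm0 : (0 : ℝ) < m := by exact_mod_cast (by omega : 0 < m)
    have hj0 : (0 : ℝ) < j := by exact_mod_cast hj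
    rw [zero_add, engelVolume_one hj (by omega), engelVolume_one hj hm, engelVolume]
    push_cast
    field_simp
    ring
  | succ n ih =>
    rw [engelVolume, Finset.sum_Ioc_succ_top (by omega)]
    have h0 : engelVolume (n + 1) (m + 1) (m + 1) = 0 := by simp [engelVolume]
    rw [h0, zero_div, add_zero, engelVolume, engelVolume, Finset.mul_sum, Finset.mul_sum,
      ← Finset.sum_add_distrib]
    refine Finset.sum_congr rfl fun k hk => ?_
    rw [Finset.mem_Ioc] at hk
    rw [← mul_div_assoc, ih (by omega) hk.2]
    ring

lemma isRecordArray_engelVolume : IsRecordArray fun n m => engelVolume n 1 m where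
  zero m _ := by simp [engelVolume]
  one n := by simp [engelVolume]
  succ n _ hm := engelVolume_recurrence n le_rfl hm

/-! ### Conclusions for the digits -/

theorem existsUnique_isModifiedEngelSeries {x : ℝ} (hx : x ∈ Set.Ioo (0 : ℝ) 1) :
    ∃! d : ℕ → ℕ, IsModifiedEngelSeries d x :=
  ⟨engelSeq x, isModifiedEngelSeries_engelSeq ⟨hx.1, hx.2.le⟩, fun _ h => h.eq_engelSeq⟩

theorem satisfiesLDP_modifiedEngelSeries (d : ℝ → ℕ → ℕ)
    (hd : ∀ x ∈ Set.Ioo (0 : ℝ) 1, IsModifiedEngelSeries (d x) x) :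
    SatisfiesLDP (volume.restrict (Set.Ioo (0 : ℝ) 1))
      (fun (n : ℕ) (x : ℝ) => (Real.log (d x n : ℝ) - n) / n) rateC := by
  have : IsProbabilityMeasure (volume.restrict (Set.Ioo (0 : ℝ) 1)) := ⟨by simp⟩
  have hae : ∀ᵐ x ∂(volume.restrict (Set.Ioo (0 : ℝ) 1)), x ∈ Set.Ioo (0 : ℝ) 1 :=
    ae_restrict_mem measurableSet_Ioo
  refine satisfiesLDP_of_isRecordArray (D := fun n x => d x n) (fun n => ?_) (fun n => ?_)
    isRecordArray_engelVolume fun n m hm => ?_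
  · refine ⟨fun x => engelSeq x n, measurable_engelSeq n, ?_⟩
    filter_upwards [hae] with x hx
    rw [(hd x hx).eq_engelSeq]
  · filter_upwards [hae] with x hx
    rw [(hd x hx).eq_engelSeq]
    exact (engelSeq_strictMono ⟨hx.1, hx.2.le⟩).monotone (Nat.zero_le n)
  · rw [← volume_engelSet n le_rfl hm]
    have h1 : {x | d x n ≤ m} =ᵐ[volume.restrict (Set.Ioo (0 : ℝ) 1)] {x | engelSeq x n ≤ m} := by
      filter_upwards [hae] with x hx
      refine propext ?_
      change d x n ≤ m ↔ engelSeq x n ≤ m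
      rw [(hd x hx).eq_engelSeq]
    have h2 : MeasurableSet {x | engelSeq x n ≤ m} := measurable_engelSeq n measurableSet_Iic
    rw [measureReal_congr h1, restrict_Ioo_eq_restrict_Ioc,
      measureReal_restrict_apply h2, Set.inter_comm]
    simp [engelSet, Set.inter_def]

/-! ### Running maxima and record times -/

/-- The maximum of `x 0, …, x m`. -/
noncomputable def runMax (x : ℕ → ℝ) : ℕ → ℝ
  | 0 => x 0
  | m + 1 => max (runMax x m) (x (m + 1))

open Classical in
/-- The number of records among `x 1, …, x m`, where `x 0` does not count. -/
noncomputable def recordCount (x : ℕ → ℝ) : ℕ → ℕ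
  | 0 => 0
  | m + 1 => recordCount x m + if runMax x m < x (m + 1) then 1 else 0

lemma le_runMax (x : ℕ → ℝ) {a m : ℕ} (h : a ≤ m) : x a ≤ runMax x m := by
  induction m, h using Nat.le_induction with
  | base => cases a with
    | zero => exact le_rfl
    | succ a => exact le_max_right _ _
  | succ m _ ih => exact ih.trans (le_max_left _ _)

lemma recordCount_mono (x : ℕ → ℝ) : Monotone (recordCount x) :=
  monotone_nat_of_le_succ fun _ => Nat.le_add_right _ _

lemma exists_gt_of_recordCount_unbounded {x : ℕ → ℝ} (h : ∀ n, ∃ m, n ≤ recordCount x m) (a : ℕ) :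
    ∃ i, a < i ∧ x a < x i := by
  by_contra! hcon
  have hconst : ∀ m, a ≤ m → recordCount x m = recordCount x a := by
    intro m hm
    induction m, hm using Nat.le_induction with
    | base => rfl
    | succ m hm ih =>
      have : ¬ runMax x m < x (m + 1) :=
        not_lt.2 ((hcon (m + 1) (by omega)).trans (le_runMax x hm))
      simp [recordCount, this, ih]
  obtain ⟨m, hm⟩ := h (recordCount x a + 1)
  have h1 := hconst (max a m) (le_max_left _ _)
  have h2 := recordCount_mono x (le_max_right a m)
  omega

namespace IsRecordTimes

variable {x : ℕ+ → ℝ} {L L' : ℕ → ℕ+}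

lemma strictMono (h : IsRecordTimes x L) : StrictMono L :=
  strictMono_nat_of_lt_succ fun n => (h.isLeast n).1.2

lemma unique (h : IsRecordTimes x L) (h' : IsRecordTimes x L') : L = L' := by
  funext n
  induction n with
  | zero => rw [h.zero, h'.zero]
  | succ n ih =>
    have h1 := h.isLeast n
    rw [ih] at h1
    exact h1.unique (h'.isLeast n)

/-- The record times interlace with the count: if N records follow the first observation by time m +
1, then m + 1 lies in [L N, L (N+1)). Position m of the shifted sequence is time m + 1. -/
lemma recordCount_spec (h : IsRecordTimes x L) (m : ℕ) :
    (L (recordCount (fun i => x i.succPNat) m) : ℕ) ≤ m + 1 ∧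
      m + 1 < (L (recordCount (fun i => x i.succPNat) m + 1) : ℕ) ∧
      x (L (recordCount (fun i => x i.succPNat) m)) = runMax (fun i => x i.succPNat) m := by
  have hlt (n : ℕ) : (L n : ℕ) < L (n + 1) := PNat.coe_lt_coe _ _ |>.2 (h.isLeast n).1.2
  induction m with
  | zero =>
    have h1 := hlt 0
    have h0 := h.zero
    simp only [recordCount, runMax, zero_add]
    refine ⟨by simp [h0], by simpa [h0] using h1, by rw [h0]; rfl⟩
  | succ m ih =>
    obtain ⟨h1, h2, h3⟩ := ih
    set N := recordCount (fun i => x i.succPNat) m with hN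
    have hj : ((m + 1).succPNat : ℕ) = m + 1 + 1 := rfl
    by_cases hr : runMax (fun i => x i.succPNat) m < x (m + 1).succPNat
    · have hN' : recordCount (fun i => x i.succPNat) (m + 1) = N + 1 := by
        simp [recordCount, hr, hN]
      have hle : L (N + 1) ≤ (m + 1).succPNat :=
        (h.isLeast N).2 ⟨by rw [h3]; exact hr, by rw [gt_iff_lt, ← PNat.coe_lt_coe]; omega⟩
      have heq : L (N + 1) = (m + 1).succPNat := by
        refine le_antisymm hle ?_
        rw [← PNat.coe_le_coe]; omega
      have h4 := hlt (N + 1)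
      rw [heq] at h4
      rw [hN', heq]
      exact ⟨hj.le, by omega, (max_eq_right hr.le).symm⟩
    · have hN' : recordCount (fun i => x i.succPNat) (m + 1) = N := by
        simp [recordCount, hr, hN]
      have hne : L (N + 1) ≠ (m + 1).succPNat := by
        intro heq
        have h4 := (h.isLeast N).1.1
        rw [heq, h3] at h4
        exact hr h4
      have hne' : (L (N + 1) : ℕ) ≠ m + 1 + 1 := fun h5 => hne (PNat.coe_injective h5)
      rw [hN']
      exact ⟨by omega, by omega, h3.trans (max_eq_left (not_lt.1 hr)).symm⟩

lemma le_iff (h : IsRecordTimes x L) (n m : ℕ) :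
    (L n : ℕ) ≤ m + 1 ↔ n ≤ recordCount (fun i => x i.succPNat) m := by
  obtain ⟨h1, h2, -⟩ := h.recordCount_spec m
  have hmono (a b : ℕ) (hab : a ≤ b) : (L a : ℕ) ≤ L b :=
    PNat.coe_le_coe _ _ |>.2 (h.strictMono.monotone hab)
  constructor
  · intro hle
    by_contra hcon
    have := hmono _ _ (not_le.1 hcon)
    simp only [Nat.succ_eq_add_one] at this
    omega
  · intro hle
    exact (hmono _ _ hle).trans h1

end IsRecordTimes

lemma exists_isRecordTimes {x : ℕ+ → ℝ} (h : ∀ n, ∃ m, n ≤ recordCount (fun i => x i.succPNat) m) :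
    ∃ L, IsRecordTimes x L := by
  have hex (j : ℕ+) : ∃ i, IsLeast {i : ℕ+ | x i > x j ∧ i > j} i := by
    have hne : {i : ℕ+ | x i > x j ∧ i > j}.Nonempty := by
      obtain ⟨i, hi1, hi2⟩ := exists_gt_of_recordCount_unbounded h j.natPred
      refine ⟨i.succPNat, ?_, ?_⟩
      · simpa using hi2
      · rw [gt_iff_lt, ← PNat.coe_lt_coe, Nat.succPNat_coe]
        have := PNat.natPred_add_one j
        omega
    obtain ⟨i, hi, hmin⟩ := wellFounded_lt.has_min _ hne
    exact ⟨i, hi, fun k hk => not_lt.1 (hmin k hk)⟩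
  choose next hnext using hex
  exact ⟨fun n => next^[n] 1, rfl, fun n => by
    rw [Function.iterate_succ_apply']; exact hnext _⟩

/-! ### Continuous distribution functions -/

section Cdf

variable {μ : Measure ℝ} [IsProbabilityMeasure μ]

lemma nullSingletonClass_of_continuous_cdf (h : Continuous (cdf μ)) : NullSingletonClass μ := by
  refine ⟨fun a => ?_⟩
  rw [← measure_cdf μ, StieltjesFunction.measure_singleton,
    h.continuousAt.continuousWithinAt.leftLim_eq, sub_self, ENNReal.ofReal_zero]

lemma real_Iio_eq_cdf (h : Continuous (cdf μ)) (t : ℝ) : μ.real (Set.Iio t) = cdf μ t := by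
  have := nullSingletonClass_of_continuous_cdf h
  rw [cdf_eq_real]
  exact measureReal_congr Iio_ae_eq_Iic

/-- The probability integral transform. -/
lemma map_cdf_eq (h : Continuous (cdf μ)) :
    μ.map (cdf μ) = volume.restrict (Set.Icc (0 : ℝ) 1) := by
  have : IsProbabilityMeasure (μ.map (cdf μ)) :=
    Measure.isProbabilityMeasure_map h.measurable.aemeasurable
  refine Measure.ext_of_Iic _ _ fun u => ?_
  rw [Measure.map_apply h.measurable measurableSet_Iic, Measure.restrict_apply measurableSet_Iic]
  rcases lt_or_ge u 0 with hu | hu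
  · have e1 : (cdf μ) ⁻¹' Set.Iic u = ∅ := by
      ext y
      simpa using hu.trans_le (cdf_nonneg μ y)
    have e2 : Set.Iic u ∩ Set.Icc (0 : ℝ) 1 = ∅ := by
      ext y
      simp only [Set.mem_inter_iff, Set.mem_Iic, Set.mem_Icc, Set.mem_empty_iff_false, iff_false]
      rintro ⟨h1, h2, _⟩
      linarith
    rw [e1, e2]; simp
  rcases le_or_gt 1 u with hu1 | hu1
  · have e1 : (cdf μ) ⁻¹' Set.Iic u = Set.univ := by
      ext y
      simpa using (cdf_le_one μ y).trans hu1
    have e2 : Set.Iic u ∩ Set.Icc (0 : ℝ) 1 = Set.Icc 0 1 :=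
      Set.inter_eq_right.2 fun y hy => hy.2.trans hu1
    rw [e1, e2]; simp
  have e2 : Set.Iic u ∩ Set.Icc (0 : ℝ) 1 = Set.Icc 0 u := by
    ext y
    simp only [Set.mem_inter_iff, Set.mem_Iic, Set.mem_Icc]
    constructor
    · rintro ⟨h1, h2, _⟩; exact ⟨h2, h1⟩
    · rintro ⟨h1, h2⟩; exact ⟨h2, h1, by linarith⟩
  rw [e2, Real.volume_Icc, sub_zero]
  rcases ((cdf μ) ⁻¹' Set.Iic u).eq_empty_or_nonempty with he | hne
  -- The distribution function tends to 0 at -∞, so an empty sublevel set leaves only u = 0.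
  · have hu0 : u ≤ 0 := by
      by_contra hcon
      obtain ⟨y, hy⟩ := ((tendsto_cdf_atBot μ).eventually_lt_const (not_le.1 hcon)).exists
      have : y ∈ (cdf μ) ⁻¹' Set.Iic u := hy.le
      rw [he] at this
      exact this
    rw [he, measure_empty, ENNReal.ofReal_of_nonpos hu0]
  · obtain ⟨y, hy⟩ := ((tendsto_cdf_atTop μ).eventually_const_lt hu1).exists
    have hub : ∀ z ∈ (cdf μ) ⁻¹' Set.Iic u, z ≤ y := by
      intro z hz
      by_contra hcon
      have h1 := monotone_cdf μ (not_le.1 hcon).le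
      have h2 : cdf μ z ≤ u := hz
      linarith
    have hs := (isClosed_Iic.preimage h).csSup_mem hne ⟨y, hub⟩
    set s := sSup ((cdf μ) ⁻¹' Set.Iic u)
    have hsu : cdf μ s ≤ u := hs
    obtain ⟨t, ht, htu⟩ := intermediate_value_Icc (hub s hs) h.continuousOn
      (show u ∈ Set.Icc _ _ from ⟨hsu, hy.le⟩)
    have hts : t ≤ s := le_csSup ⟨y, hub⟩ htu.le
    -- By continuity the value u is attained at the right end s, so the sublevel set is the
    -- half-line up to s.
    have hst : cdf μ s = u := by rw [← htu, le_antisymm hts ht.1]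
    have e : (cdf μ) ⁻¹' Set.Iic u = Set.Iic s := by
      ext z
      exact ⟨fun hz => le_csSup ⟨y, hub⟩ hz, fun hz => (monotone_cdf μ hz).trans hsu⟩
    rw [e, ← ofReal_cdf, hst]

lemma setIntegral_cdf_pow (h : Continuous (cdf μ)) (k : ℕ) (t : ℝ) :
    ∫ x in Set.Iio t, (cdf μ x) ^ k ∂μ = (cdf μ t) ^ (k + 1) / (k + 1) := by
  have h0 := cdf_nonneg μ t
  have h1 := cdf_le_one μ t
  have e0 : Set.Iio (cdf μ t) ∩ Set.Icc (0 : ℝ) 1 = Set.Ico 0 (cdf μ t) := by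
    ext y
    simp only [Set.mem_inter_iff, Set.mem_Iio, Set.mem_Icc, Set.mem_Ico]
    constructor
    · rintro ⟨a, b, _⟩; exact ⟨b, a⟩
    · rintro ⟨a, b⟩; exact ⟨b, a, by linarith⟩
  have hsub : (cdf μ) ⁻¹' Set.Iio (cdf μ t) ⊆ Set.Iio t := by
    intro y hy
    by_contra hcon
    exact absurd (monotone_cdf μ (not_lt.1 hcon)) (not_le.2 hy)
  have hmeas : μ ((cdf μ) ⁻¹' Set.Iio (cdf μ t)) = μ (Set.Iio t) := by
    rw [← Measure.map_apply h.measurable measurableSet_Iio, map_cdf_eq h,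
      Measure.restrict_apply measurableSet_Iio, e0, Real.volume_Ico, sub_zero,
      ← real_Iio_eq_cdf h, ofReal_measureReal]
  -- The two sets can differ on a flat piece of the distribution function, which carries no mass.
  have hae : (cdf μ) ⁻¹' Set.Iio (cdf μ t) =ᵐ[μ] Set.Iio t :=
    ae_eq_of_subset_of_measure_ge hsub hmeas.ge
      (h.measurable measurableSet_Iio).nullMeasurableSet (measure_ne_top _ _)
  rw [← setIntegral_congr_set hae,
    ← setIntegral_map (f := fun u : ℝ => u ^ k) measurableSet_Iio
      (by fun_prop) h.measurable.aemeasurable, map_cdf_eq h,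
    Measure.restrict_restrict measurableSet_Iio, e0, integral_Ico_eq_integral_Ioc,
    ← intervalIntegral.integral_of_le h0, integral_pow]
  simp

end Cdf

/-! ### The distribution of the record times -/

lemma measurable_runMax_recordCount {Ω : Type*} {m₀ : MeasurableSpace Ω} {X : ℕ → Ω → ℝ} {m : ℕ}
    (h : ∀ i ≤ m, Measurable[m₀] (X i)) :
    Measurable[m₀] (fun ω => runMax (fun i => X i ω) m) ∧
      Measurable[m₀] (fun ω => recordCount (fun i => X i ω) m) := by
  induction m with
  | zero => exact ⟨h 0 le_rfl, measurable_const⟩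
  | succ m ih =>
    obtain ⟨h1, h2⟩ := ih fun i hi => h i (by omega)
    refine ⟨h1.max (h (m + 1) le_rfl), h2.add ?_⟩
    exact Measurable.ite (measurableSet_lt h1 (h (m + 1) le_rfl)) measurable_const measurable_const

lemma indepFun_recordCount_runMax {Ω : Type*} [MeasurableSpace Ω] {P : Measure Ω} {X : ℕ → Ω → ℝ}
    (hX : ∀ n, Measurable (X n)) (hind : iIndepFun X P) (m : ℕ) :
    IndepFun (fun ω => (recordCount (fun i => X i ω) m, runMax (fun i => X i ω) m)) (X (m + 1))
      P := by
  have h1 := (hind.indep_comap_natural_of_lt (fun i => (hX i).stronglyMeasurable)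
    (Nat.lt_succ_self m)).symm
  have h2 : ∀ i ≤ m, Measurable[Filtration.natural X (fun i => (hX i).stronglyMeasurable) m] (X i) :=
    fun i hi => ((Filtration.stronglyAdapted_natural fun i => (hX i).stronglyMeasurable) i).measurable.mono
      (Filtration.mono _ hi) le_rfl
  obtain ⟨h3, h4⟩ := measurable_runMax_recordCount h2
  rw [IndepFun_iff_Indep]
  exact indep_of_indep_of_le_left h1 (h4.prodMk h3).comap_le

section Records

variable {Ω : Type*} [MeasurableSpace Ω] {P : Measure Ω} [IsProbabilityMeasure P]

/-- Conditioning on the value of X by Fubini reduces the probability to the integral of a * F^k dF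
over (-∞, t). -/
lemma measureReal_lt_lt {N : Ω → ℕ} {M X : Ω → ℝ} (hN : Measurable N) (hM : Measurable M)
    (hX : Measurable X) (hind : IndepFun (fun ω => (N ω, M ω)) X P)
    (hc : Continuous (cdf (P.map X))) {a : ℝ} (ha : 0 ≤ a) {n k : ℕ}
    (h : ∀ t, P.real {ω | n ≤ N ω ∧ M ω < t} = a * (cdf (P.map X) t) ^ k) (t : ℝ) :
    P.real {ω | n ≤ N ω ∧ M ω < X ω ∧ X ω < t} = a * (cdf (P.map X) t) ^ (k + 1) / (k + 1) := by
  have : IsProbabilityMeasure (P.map X) := Measure.isProbabilityMeasure_map hX.aemeasurable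
  have hNM : Measurable fun ω => (N ω, M ω) := hN.prodMk hM
  have : IsProbabilityMeasure (P.map fun ω => (N ω, M ω)) :=
    Measure.isProbabilityMeasure_map hNM.aemeasurable
  have hmap := (indepFun_iff_map_prod_eq_prod_map_map hNM.aemeasurable hX.aemeasurable).1 hind
  set S : Set ((ℕ × ℝ) × ℝ) := {z | n ≤ z.1.1 ∧ z.1.2 < z.2 ∧ z.2 < t} with hS
  have hSm : MeasurableSet S := by
    refine MeasurableSet.inter ?_ (MeasurableSet.inter ?_ ?_)
    · exact (measurable_fst.comp measurable_fst) measurableSet_Ici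
    · exact measurableSet_lt (measurable_snd.comp measurable_fst) measurable_snd
    · exact measurable_snd measurableSet_Iio
  have h1 : P {ω | n ≤ N ω ∧ M ω < X ω ∧ X ω < t} =
      ∫⁻ x in Set.Iio t, ENNReal.ofReal (a * (cdf (P.map X) x) ^ k) ∂(P.map X) := by
    calc P {ω | n ≤ N ω ∧ M ω < X ω ∧ X ω < t}
        = P.map (fun ω => ((N ω, M ω), X ω)) S := by
          rw [Measure.map_apply (hNM.prodMk hX) hSm]; rfl
      _ = ∫⁻ x, (P.map fun ω => (N ω, M ω)) ((fun z => (z, x)) ⁻¹' S) ∂(P.map X) := by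
          rw [hmap, Measure.prod_apply_symm hSm]
      _ = ∫⁻ x, (Set.Iio t).indicator
            (fun x => ENNReal.ofReal (a * (cdf (P.map X) x) ^ k)) x ∂(P.map X) := by
          refine lintegral_congr fun x => ?_
          rw [Measure.map_apply hNM (measurable_prodMk_right hSm)]
          by_cases hx : x < t
          · rw [Set.indicator_of_mem (show x ∈ Set.Iio t from hx), ← h x, ofReal_measureReal]
            congr 1
            ext ω
            simp [hS, hx]
          · rw [Set.indicator_of_notMem (show x ∉ Set.Iio t from hx)]
            have : (fun ω => (N ω, M ω)) ⁻¹' ((fun z => (z, x)) ⁻¹' S) = ∅ := by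
              ext ω
              simp [hS, hx]
            rw [this, measure_empty]
      _ = _ := lintegral_indicator measurableSet_Iio _
  have hnn (x : ℝ) : 0 ≤ a * (cdf (P.map X) x) ^ k :=
    mul_nonneg ha (pow_nonneg (cdf_nonneg _ _) _)
  have hint : Integrable (fun x => a * (cdf (P.map X) x) ^ k) ((P.map X).restrict (Set.Iio t)) := by
    refine Integrable.of_bound (C := a) ?_ (Eventually.of_forall fun x => ?_)
    · exact (continuous_const.mul (hc.pow k)).aestronglyMeasurable
    · rw [Real.norm_of_nonneg (hnn x)]
      exact mul_le_of_le_one_right ha (pow_le_one₀ (cdf_nonneg _ _) (cdf_le_one _ _))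
  rw [measureReal_def, h1, ← ofReal_integral_eq_lintegral_ofReal hint (Eventually.of_forall hnn),
    ENNReal.toReal_ofReal (integral_nonneg hnn), integral_const_mul, setIntegral_cdf_pow hc,
    mul_div_assoc]

lemma measureReal_lt_and_lt {N : Ω → ℕ} {M X : Ω → ℝ} (hX : Measurable X)
    (hind : IndepFun (fun ω => (N ω, M ω)) X P)
    (hc : Continuous (cdf (P.map X))) {a : ℝ} {n k : ℕ}
    (h : ∀ t, P.real {ω | n ≤ N ω ∧ M ω < t} = a * (cdf (P.map X) t) ^ k) (t : ℝ) :
    P.real {ω | n ≤ N ω ∧ M ω < t ∧ X ω < t} = a * (cdf (P.map X) t) ^ (k + 1) := by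
  have : IsProbabilityMeasure (P.map X) := Measure.isProbabilityMeasure_map hX.aemeasurable
  have h1 := hind.measure_inter_preimage_eq_mul (Set.Ici n ×ˢ Set.Iio t) (Set.Iio t)
    (measurableSet_Ici.prod measurableSet_Iio) measurableSet_Iio
  have e1 : (fun ω => (N ω, M ω)) ⁻¹' (Set.Ici n ×ˢ Set.Iio t) = {ω | n ≤ N ω ∧ M ω < t} := rfl
  have e2 : {ω | n ≤ N ω ∧ M ω < t ∧ X ω < t} =
      (fun ω => (N ω, M ω)) ⁻¹' (Set.Ici n ×ˢ Set.Iio t) ∩ X ⁻¹' Set.Iio t := by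
    ext ω
    simp [and_assoc]
  rw [measureReal_def, e2, h1, ENNReal.toReal_mul, e1, ← measureReal_def, h t, pow_succ,
    ← real_Iio_eq_cdf hc t, map_measureReal_apply hX measurableSet_Iio, ← measureReal_def, mul_assoc]

variable {X : ℕ → Ω → ℝ}

/-- Record count and running maximum are independent. Carrying the maximum along is what lets the
induction close, since the next record depends on the past through it. -/
lemma measureReal_recordCount_lt (hX : ∀ n, Measurable (X n)) (hind : iIndepFun X P)
    (hid : ∀ n, P.map (X n) = P.map (X 0)) (hc : Continuous (cdf (P.map (X 0))))
    {p : ℕ → ℕ → ℝ} (hp : IsRecordArray p) (m n : ℕ) (t : ℝ) :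
    P.real {ω | n ≤ recordCount (fun i => X i ω) m ∧ runMax (fun i => X i ω) m < t} =
      p n (m + 1) * (cdf (P.map (X 0)) t) ^ (m + 1) := by
  have hpnn (n m : ℕ) : 0 ≤ p n (m + 1) := by
    have := hp.isSymmArray.nonneg (fun m => by simp [hp.zero (m + 1) (by omega)])
      (fun n => by simp [hp.one]) m n
    exact nonneg_of_mul_nonneg_right this (by positivity)
  have : IsProbabilityMeasure (P.map (X 0)) := Measure.isProbabilityMeasure_map (hX 0).aemeasurable
  induction m generalizing n t with
  | zero =>
    cases n with
    | zero =>
      rw [hp.zero _ le_rfl, one_mul, zero_add, pow_one, ← real_Iio_eq_cdf hc t,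
        map_measureReal_apply (hX 0) measurableSet_Iio]
      simp [recordCount, runMax, Set.preimage]
    | succ n => simp [recordCount, hp.one]
  | succ m ih =>
    have hcm : Continuous (cdf (P.map (X (m + 1)))) := by rwa [hid]
    have hind' := indepFun_recordCount_runMax hX hind m
    obtain ⟨hM, hN⟩ := measurable_runMax_recordCount (m := m) fun i _ => hX i
    have hlt (n : ℕ) : P.real {ω | n ≤ recordCount (fun i => X i ω) m ∧
        runMax (fun i => X i ω) m < X (m + 1) ω ∧ X (m + 1) ω < t} =
        p n (m + 1) * (cdf (P.map (X 0)) t) ^ (m + 1 + 1) / (m + 1 + 1) := by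
      have := measureReal_lt_lt hN hM (hX (m + 1)) hind' hcm (hpnn n m) (n := n) (k := m + 1)
        (by rw [hid]; exact ih n) t
      rw [hid] at this
      exact_mod_cast this
    have hand (n : ℕ) : P.real {ω | n ≤ recordCount (fun i => X i ω) m ∧
        runMax (fun i => X i ω) m < t ∧ X (m + 1) ω < t} =
        p n (m + 1) * (cdf (P.map (X 0)) t) ^ (m + 1 + 1) := by
      have := measureReal_lt_and_lt (hX (m + 1)) hind' hcm (n := n) (k := m + 1)
        (by rw [hid]; exact ih n) t
      rwa [hid] at this
    cases n with
    | zero =>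
      rw [hp.zero _ (by omega), ← hp.zero (m + 1) (by omega), ← hand 0]
      simp [runMax]
    | succ n =>
      set E₁ := {ω | n + 1 ≤ recordCount (fun i => X i ω) m ∧
        runMax (fun i => X i ω) m < t ∧ X (m + 1) ω < t} with hE₁
      set E₂ := {ω | n ≤ recordCount (fun i => X i ω) m ∧
        runMax (fun i => X i ω) m < X (m + 1) ω ∧ X (m + 1) ω < t} with hE₂
      have hE₂m : MeasurableSet E₂ :=
        (hN measurableSet_Ici).inter ((measurableSet_lt hM (hX (m + 1))).inter
          (hX (m + 1) measurableSet_Iio))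
      -- `E₁` needs no new record and `E₂` uses one. Their overlap has n + 1 records already and
      -- gains another, so inclusion-exclusion yields the recurrence with weight 1/(m+2).
      have hunion : {ω | n + 1 ≤ recordCount (fun i => X i ω) (m + 1) ∧
          runMax (fun i => X i ω) (m + 1) < t} = E₁ ∪ E₂ := by
        ext ω
        simp only [hE₁, hE₂, Set.mem_union, Set.mem_ofPred_eq, recordCount, runMax, max_lt_iff]
        by_cases hr : runMax (fun i => X i ω) m < X (m + 1) ω
        · simp only [hr, if_true, true_and, Nat.add_le_add_iff_right]
          constructor
          · rintro ⟨h1, h2, h3⟩; exact Or.inr ⟨h1, h3⟩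
          · rintro (⟨h1, h2, h3⟩ | ⟨h1, h3⟩)
            · exact ⟨by omega, h2, h3⟩
            · exact ⟨h1, hr.trans h3, h3⟩
        · simp [hr]
      have hinter : E₁ ∩ E₂ = {ω | n + 1 ≤ recordCount (fun i => X i ω) m ∧
          runMax (fun i => X i ω) m < X (m + 1) ω ∧ X (m + 1) ω < t} := by
        ext ω
        simp only [hE₁, hE₂, Set.mem_inter_iff, Set.mem_ofPred_eq]
        constructor
        · rintro ⟨⟨h1, _, h2⟩, _, h3, _⟩; exact ⟨h1, h3, h2⟩
        · rintro ⟨h1, h2, h3⟩; exact ⟨⟨h1, h2.trans h3, h3⟩, by omega, h2, h3⟩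
      have h1 := measureReal_union_add_inter (μ := P) (s := E₁) hE₂m
      rw [hinter, hlt, hlt, hand, ← hunion] at h1
      have h2 := hp.succ' n m
      have h3 : p (n + 1) (m + 1 + 1) =
          (((m : ℝ) + 1) * p (n + 1) (m + 1) + p n (m + 1)) / ((m : ℝ) + 1 + 1) := by
        rw [eq_div_iff (by positivity), mul_comm]
        exact h2
      rw [h3, eq_sub_of_add_eq h1]
      field_simp
      ring

lemma measureReal_recordCount (hX : ∀ n, Measurable (X n)) (hind : iIndepFun X P)
    (hid : ∀ n, P.map (X n) = P.map (X 0)) (hc : Continuous (cdf (P.map (X 0))))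
    {p : ℕ → ℕ → ℝ} (hp : IsRecordArray p) (m n : ℕ) :
    P.real {ω | n ≤ recordCount (fun i => X i ω) m} = p n (m + 1) := by
  have key := measureReal_recordCount_lt hX hind hid hc hp m
  obtain ⟨hM, hN⟩ := measurable_runMax_recordCount (m := m) fun i _ => hX i
  have hlim (a : ℝ) :
      Tendsto (fun t => a * (cdf (P.map (X 0)) t) ^ (m + 1)) atTop (nhds a) := by
    simpa using ((tendsto_cdf_atTop (P.map (X 0))).pow (m + 1)).const_mul a
  apply le_antisymm
  · have h1 : Tendsto (fun t => p n (m + 1) * (cdf (P.map (X 0)) t) ^ (m + 1) +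
        (1 - 1 * (cdf (P.map (X 0)) t) ^ (m + 1))) atTop (nhds (p n (m + 1) + (1 - 1))) :=
      (hlim _).add ((hlim 1).const_sub 1)
    rw [sub_self, add_zero] at h1
    refine ge_of_tendsto' h1 fun t => ?_
    have h0 := key 0 t
    rw [hp.zero _ (by omega)] at h0
    rw [← key n t, ← h0]
    have hm0 : MeasurableSet {ω | 0 ≤ recordCount (fun i => X i ω) m ∧
        runMax (fun i => X i ω) m < t} :=
      (hN measurableSet_Ici).inter (hM measurableSet_Iio)
    rw [← probReal_compl_eq_one_sub hm0]
    -- Discarding the event that the maximum is at least t costs 1 - F(t)^(m+1), by the case n = 0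
    -- of the joint law.
    refine (measureReal_mono ?_).trans (measureReal_union_le _ _)
    intro ω hω
    by_cases ht : runMax (fun i => X i ω) m < t
    · exact Or.inl ⟨hω, ht⟩
    · exact Or.inr fun h => ht h.2
  · refine le_of_tendsto' (hlim _) fun t => ?_
    rw [← key n t]
    exact measureReal_mono fun ω hω => hω.1

lemma tendsto_exp_neg_half_log (n : ℕ) :
    Tendsto (fun m : ℕ => Real.exp ((1 / 2 : ℝ) * (1 + Real.log ((m + 1 : ℕ) : ℝ)) -
      Real.log ((m + 1 : ℕ) : ℝ) - n * Real.log (1 / 2 : ℝ))) atTop (nhds 0) := by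
  apply Real.tendsto_exp_atBot.comp
  have h1 : Tendsto (fun m : ℕ => Real.log ((m + 1 : ℕ) : ℝ)) atTop atTop :=
    Real.tendsto_log_atTop.comp
      (tendsto_natCast_atTop_atTop.comp (tendsto_add_atTop_nat 1))
  have h2 := tendsto_atBot_add_const_right atTop (1 / 2 - n * Real.log (1 / 2 : ℝ))
    (h1.const_mul_atTop_of_neg (by norm_num : (-(1 / 2) : ℝ) < 0))
  refine h2.congr fun m => ?_
  ring

/-- The probability of fewer than n records up to m is 1 - p n (m+1), and the exponential bound with
θ = 1/2 sends it to 0. -/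
lemma ae_recordCount_unbounded (hX : ∀ n, Measurable (X n)) (hind : iIndepFun X P)
    (hid : ∀ n, P.map (X n) = P.map (X 0)) (hc : Continuous (cdf (P.map (X 0))))
    {p : ℕ → ℕ → ℝ} (hp : IsRecordArray p) :
    ∀ᵐ ω ∂P, ∀ n, ∃ m, n ≤ recordCount (fun i => X i ω) m := by
  rw [ae_all_iff]
  intro n
  rw [ae_iff, ← measureReal_eq_zero_iff]
  refine le_antisymm (ge_of_tendsto' (tendsto_exp_neg_half_log n) fun m => ?_) measureReal_nonneg
  have hN := (measurable_runMax_recordCount (m := m) fun i _ => hX i).2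
  have hm0 : MeasurableSet {ω | n ≤ recordCount (fun i => X i ω) m} := hN measurableSet_Ici
  refine le_trans ?_ (hp.compl_le_exp (by norm_num) (by norm_num) (by omega) n)
  rw [← measureReal_recordCount hX hind hid hc hp m n, ← probReal_compl_eq_one_sub hm0]
  exact measureReal_mono fun ω hω h => hω ⟨m, h⟩

end Records

/-! ### Conclusions for the record times -/

theorem ae_existsUnique_and_satisfiesLDP_recordTimes {Ω : Type*} [MeasurableSpace Ω]
    (P : Measure Ω) [IsProbabilityMeasure P] (X : ℕ+ → Ω → ℝ) (hX : ∀ n, Measurable (X n))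
    (hind : iIndepFun X P) (hid : ∀ n, IdentDistrib (X n) (X 1) P P)
    (hc : Continuous (cdf (P.map (X 1)))) :
    (∀ᵐ ω ∂P, ∃! L : ℕ → ℕ+, IsRecordTimes (fun k => X k ω) L) ∧
      ∀ L : Ω → ℕ → ℕ+, (∀ᵐ ω ∂P, IsRecordTimes (fun k => X k ω) (L ω)) →
        SatisfiesLDP P (fun (n : ℕ) (ω : Ω) => (Real.log (L ω n : ℝ) - n) / n) rateC := by
  set X' : ℕ → Ω → ℝ := fun i => X i.succPNat with hX'
  have hXm : ∀ n, Measurable (X' n) := fun n => hX _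
  have hind' : iIndepFun X' P := hind.precomp Nat.succPNat_injective
  have hid' : ∀ n, P.map (X' n) = P.map (X' 0) := fun n => (hid _).map_eq
  have hc' : Continuous (cdf (P.map (X' 0))) := hc
  -- The recurrence and boundary values fix the relevant entries, so the array built from the digits
  -- also serves the record times.
  have hp := isRecordArray_engelVolume
  constructor
  · filter_upwards [ae_recordCount_unbounded hXm hind' hid' hc' hp] with ω hω
    obtain ⟨L, hL⟩ := exists_isRecordTimes (x := fun k => X k ω) hω
    exact ⟨L, hL, fun L' hL' => IsRecordTimes.unique hL' hL⟩
  · intro L hL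
    have hae (n m : ℕ) : {ω | (L ω n : ℕ) ≤ m + 1} =ᵐ[P]
        {ω | n ≤ recordCount (fun i => X' i ω) m} := by
      filter_upwards [hL] with ω hω
      exact propext (hω.le_iff n m)
    -- The choice of L is arbitrary off a null set; its sublevel sets agree almost everywhere with
    -- measurable events for the record count.
    have hnull (n : ℕ) : NullMeasurable (fun ω => (L ω n : ℕ)) P := by
      refine @measurable_of_Iic ℕ (NullMeasurableSpace Ω P) _ _ _ _ _ _ _ _ fun k => ?_
      cases k with
      | zero =>
        have : (fun ω => (L ω n : ℕ)) ⁻¹' Set.Iic 0 = ∅ := by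
          ext ω; simp
        have hempty : NullMeasurableSet ((fun ω => (L ω n : ℕ)) ⁻¹' Set.Iic 0) P := by
          rw [this]; exact nullMeasurableSet_empty
        exact hempty
      | succ m =>
        exact ((measurable_runMax_recordCount (m := m) fun i _ => hXm i).2
          measurableSet_Ici).nullMeasurableSet.congr (hae n m).symm
    refine satisfiesLDP_of_isRecordArray (D := fun n ω => (L ω n : ℕ))
      (fun n => (hnull n).aemeasurable) (fun n => Eventually.of_forall fun ω => (L ω n).pos) hp
      fun n m hm => ?_
    obtain ⟨m, rfl⟩ : ∃ k, m = k + 1 := ⟨m - 1, by omega⟩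
    rw [measureReal_congr (hae n m)]
    exact measureReal_recordCount hXm hind' hid' hc' hp m n

theorem corollary1p2 :
    ((∀ x ∈ Set.Ioo (0 : ℝ) 1, ∃! d : ℕ → ℕ, IsModifiedEngelSeries d x) ∧
      ∀ d : ℝ → ℕ → ℕ, (∀ x ∈ Set.Ioo (0 : ℝ) 1, IsModifiedEngelSeries (d x) x) →
        SatisfiesLDP (volume.restrict (Set.Ioo (0 : ℝ) 1))
          (fun (n : ℕ) (x : ℝ) => (Real.log (d x n : ℝ) - n) / n) rateC) ∧
    (∀ (Ω : Type*) [MeasurableSpace Ω] (P : Measure Ω) [IsProbabilityMeasure P]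
      (X : ℕ+ → Ω → ℝ), (∀ n, Measurable (X n)) → iIndepFun X P →
      (∀ n, IdentDistrib (X n) (X 1) P P) → Continuous (cdf (P.map (X 1))) →
      (∀ᵐ ω ∂P, ∃! L : ℕ → ℕ+, IsRecordTimes (fun k => X k ω) L) ∧
      ∀ L : Ω → ℕ → ℕ+, (∀ᵐ ω ∂P, IsRecordTimes (fun k => X k ω) (L ω)) →
        SatisfiesLDP P (fun (n : ℕ) (ω : Ω) => (Real.log (L ω n : ℝ) - n) / n) rateC) :=
  ⟨⟨fun _ hx => existsUnique_isModifiedEngelSeries hx, satisfiesLDP_modifiedEngelSeries⟩,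
    fun _ _ P _ X hX hind hid hc =>
      ae_existsUnique_and_satisfiesLDP_recordTimes P X hX hind hid hc⟩
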